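/- Conventions. Let $G$ be a finitely generated group and $\mu$ a symmetric probability measure on $G$ whose support is finite and generates $G$. For a finite generating set $S$ of $G$ let $d=d_S$ be the word distance, let $\mu^{(n)}$ be the $n$-fold convolution power of $\mu$ (the law of the random walk $X_n=\xi_1\cdots\xi_n$ with $\xi_i$ i.i.d. of law $\mu$), and let $\mathbb{E}_{\mu^{(n)}}d(e,x)=\sum_{x\in G}\mu^{(n)}(x)\,d(e,x)$. A function $h:G\to\mathbb{R}$ is $\mu$-harmonic if $\sum_{g}h(xg)\mu(g)=h(x)$ for all $x\in G$. Put $M_h(n)=\max\{|h(x)|:d(e,x)\le n\}$; $h$ has sub-exponential growth if $e^{-cn}M_h(n)\to0$ as $n\to\infty$ for every $c>0$, and it is sublinear if $M_h(n)/n\to0$ as $n\to\infty$. For a group $F$, $F\wr\mathbb{Z}$ is the restricted wreath product, i.e. the pairs $(\varphi,x)$ with $\varphi:\mathbb{Z}\to F$ of finite support and $x\in\mathbb{Z}$, with product $(\varphi,x)(\psi,y)=(\varphi\cdot\psi(\cdot-x),\,x+y)$. Statement. Let $f:[0,\infty)\to[0,\infty)$ be sub-additive, i.e. $f(x+y)\le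 f(x)+f(y)$ for all $x,y$, with $f(x)/x\to0$ as $x\to\infty$. Then there are a finitely generated group $\Delta$ and a symmetric probability measure $\mu$ on $\Delta$ with finite generating support such that: (1) for every finite generating set of $\Delta$ there is a constant $c>0$ such that $\mathbb{E}_{\mu^{(n)}}d(e,x)\ge c f(n)$ for all $n\ge1$; (2) there are a finite group $F$ and a surjective homomorphism $\pi:\Delta\to F\wr\mathbb{Z}$ such that every $\mu$-harmonic function $h:\Delta\to\mathbb{R}$ of sub-exponential growth factors through $\pi$, i.e. $h=k\circ\pi$ for some $k:F\wr\mathbb{Z}\to\mathbb{R}$; (3) every sublinear $\mu$-harmonic function $h:\Delta\to\mathbb{R}$ is constant. Consequently, the absence of non-constant sublinear harmonic functions does not imply diffusive speed: there are a finitely generated group $\Delta$ and a symmetric probability measure $\mu$ on $\Delta$ with finite generating support such that all sublinear $\mu$-harmonic functions on $\Delta$ are constant, while for no finite generating set of $\Delta$ is there a constant $C$ with $\mathbb{E}_{\mu^{(n)}}d(e,x)\le C\sqrt{n}$ for all $n\ge1$. -/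

import Mathlib

open Filter Topology
open scoped NNReal ENNReal

/-- The restricted wreath product `F ≀ ℤ`: the pairs `(φ, x)` with a finitely supported lamp
configuration `φ : ℤ → F` and a cursor position `x : ℤ`, inside the unrestricted regular wreath
product. -/
def lamplighter (F : Type*) [Group F] : Subgroup (RegularWreathProduct F (Multiplicative ℤ)) where
  carrier := {w | (Function.mulSupport w.left).Finite}
  one_mem' := by simp
  mul_mem' := by
    intro a b ha hb
    have hb' : (Function.mulSupport fun x => b.left (a.right⁻¹ * x)).Finite :=
      Set.Finite.preimage (f := fun x => a.right⁻¹ * x) (mul_right_injective _).injOn hb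
    exact (ha.union hb').subset (Function.mulSupport_mul _ _)
  inv_mem' := by
    intro a ha
    have ha' : (Function.mulSupport fun x => a.left (a.right * x)).Finite :=
      Set.Finite.preimage (f := fun x => a.right * x) (mul_right_injective _).injOn ha
    exact ha'.subset fun x hx h => hx (by simp [h])

section RandomWalk

variable {G : Type*} [Group G]

/-- The word length `d(e, g)` with respect to `S`: the least length of a word in the letters
`S ∪ S⁻¹` that represents `g`. -/
noncomputable def wordLength (S : Set G) (g : G) : ℕ :=
  sInf {n : ℕ | ∃ l : List G, l.length = n ∧ (∀ s ∈ l, s ∈ S ∨ s⁻¹ ∈ S) ∧ l.prod = g}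

/-- `S` is a finite generating set of `G`. -/
def IsFiniteGenerating (S : Set G) : Prop :=
  S.Finite ∧ Subgroup.closure S = ⊤

/-- `μ` is a symmetric probability measure with finite generating support. -/
def IsSymmFiniteGenerating (μ : PMF G) : Prop :=
  (∀ g, μ g⁻¹ = μ g) ∧ IsFiniteGenerating μ.support

/-- The convolution power `μ^(n)`, the law of `X_n = ξ₁ ξ₂ ⋯ ξ_n` with `ξᵢ` independent of
law `μ`. -/
noncomputable def convPow (μ : PMF G) : ℕ → PMF G
  | 0 => PMF.pure 1
  | n + 1 => (convPow μ n).bind fun x => μ.map fun g => x * g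

/-- The expected distance `𝔼 d(e, X_n)`; the sum is finite when `μ` has finite support. -/
noncomputable def speed (S : Set G) (μ : PMF G) (n : ℕ) : ℝ :=
  ∑' x : G, (convPow μ n x).toReal * (wordLength S x : ℝ)

/-- `h` is `μ`-harmonic: `∑ g, h (x g) μ(g) = h x` for all `x`. -/
def IsHarmonic (μ : PMF G) (h : G → ℝ) : Prop :=
  ∀ x : G, ∑' g : G, h (x * g) * (μ g).toReal = h x

/-- `M_h(n)`, the maximum of `|h|` on the ball of radius `n` around `e`, which is a finite
set when `S` is finite and generating. -/
noncomputable def maxOnBall (S : Set G) (h : G → ℝ) (n : ℕ) : ℝ :=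
  sSup ((fun x => |h x|) '' {x : G | wordLength S x ≤ n})

/-- `h` has sub-exponential growth. -/
def HasSubexponentialGrowth (S : Set G) (h : G → ℝ) : Prop :=
  ∀ c : ℝ, 0 < c → Tendsto (fun n : ℕ => Real.exp (-c * n) * maxOnBall S h n) atTop (𝓝 0)

/-- `h` has sublinear growth. -/
def HasSublinearGrowth (S : Set G) (h : G → ℝ) : Prop :=
  Tendsto (fun n : ℕ => maxOnBall S h n / n) atTop (𝓝 0)

/-- Every `μ`-harmonic function of sublinear growth is constant. -/
def SublinearHarmonicConstant (S : Set G) (μ : PMF G) : Prop :=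
  ∀ h : G → ℝ, IsHarmonic μ h → HasSublinearGrowth S h → ∃ a : ℝ, ∀ x, h x = a

/-- The `μ`-random walk is at most diffusive: `𝔼 d(e, X_n) ≤ C √n`. -/
def HasDiffusiveSpeed (S : Set G) (μ : PMF G) : Prop :=
  ∃ C : ℝ, ∀ n : ℕ, 1 ≤ n → speed S μ n ≤ C * Real.sqrt n

end RandomWalk

/-!
The group `Δ` is a diagonal product. Its factors are the lamplighter group `ℤˣ ≀ ℤ` and, for each
`s`, a finite group of permutations of a tree of cycles; `Δ` is generated by an involution and a
translation acting diagonally, and the walk takes the steps `1, a, t, t⁻¹` with equal probability.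

In the factor with index `s`, the translation `t` rotates all cycles (of length `3 K`, `K = s + 2`)
and the involution `a` jumps between adjacent cycles, at positions that are multiples of `K`. The
supports of `a` and `t ^ d * a * t ^ (-d)` are therefore disjoint for `0 < |d| < K`, and the short
relations of the lamplighter group hold in this factor (`evalWord_eq_one_of_lamplighter`). Hence an
element of the kernel of `Δ → ℤˣ ≀ ℤ` is trivial in all but finitely many factors, which are finite
groups: the kernel is a union of finite normal subgroups. Such a subgroup acts trivially on the
harmonic functions of sub-exponential growth, because the walk reaches any of its elements within
bounded time with probability bounded below, so that the increments under it contract by a constant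
factor each time the radius grows by a constant (`IsHarmonic.mul_left_eq_of_mem`).

On the other hand, a tree of cycles is a subdivision of a branching tree, and the walk has speed of
order `1 / K` on it until it reaches the leaves: an explicit potential has drift `1 / 2` per step
and increments at most `6 K` (`cyclePotential_drift`). The depth of the tree with index `s` is free,
so it can be taken so large that this bound is in force at all times up to the time when the next
factor gives speed at least `f` (`exists_depths`). As `f` is sublinear, any rate `1 / K` suffices.

Finally, a sublinear harmonic function on `ℤˣ ≀ ℤ` is constant. Its increment under the switch of the
lamp at `x` is a harmonic function that is averaged to zero by the lazy step when the cursor is at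
`x`; its supremum over the lamps is then a subharmonic function of the cursor with killing at `x`,
and grows linearly unless it vanishes (`IsHarmonic.abs_lamp_increment_mul_le`). So the function
depends on the cursor only, and is affine in it.
-/

/-! ### Word length -/

section WordLength

variable {G : Type*} [Group G] {S : Set G}

theorem exists_list_of_closure_eq_top (hS : Subgroup.closure S = ⊤) (g : G) :
    ∃ l : List G, (∀ s ∈ l, s ∈ S ∨ s⁻¹ ∈ S) ∧ l.prod = g := by
  have hg : g ∈ (Subgroup.closure S).toSubmonoid := by rw [hS]; trivial
  rw [Subgroup.closure_toSubmonoid] at hg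
  obtain ⟨l, hl, hp⟩ := Submonoid.exists_list_of_mem_closure hg
  exact ⟨l, fun s hs => by simpa using hl s hs, hp⟩

theorem exists_list_length_eq_wordLength (hS : IsFiniteGenerating S) (g : G) :
    ∃ l : List G, l.length = wordLength S g ∧ (∀ s ∈ l, s ∈ S ∨ s⁻¹ ∈ S) ∧ l.prod = g := by
  obtain ⟨l, hl, hp⟩ := exists_list_of_closure_eq_top hS.2 g
  exact Nat.sInf_mem (s := {n : ℕ | ∃ l : List G, l.length = n ∧
    (∀ s ∈ l, s ∈ S ∨ s⁻¹ ∈ S) ∧ l.prod = g}) ⟨_, l, rfl, hl, hp⟩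

theorem wordLength_one (S : Set G) : wordLength S 1 = 0 :=
  Nat.le_zero.1 (Nat.sInf_le ⟨[], rfl, by simp, rfl⟩)

theorem wordLength_mul_le (hS : IsFiniteGenerating S) (g h : G) :
    wordLength S (g * h) ≤ wordLength S g + wordLength S h := by
  obtain ⟨l, hl, hlS, rfl⟩ := exists_list_length_eq_wordLength hS g
  obtain ⟨m, hm, hmS, rfl⟩ := exists_list_length_eq_wordLength hS h
  rw [← hl, ← hm]
  refine Nat.sInf_le ⟨l ++ m, by simp, ?_, by simp⟩
  intro s hs
  rcases List.mem_append.1 hs with h | h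
  exacts [hlS s h, hmS s h]

theorem finite_setOf_wordLength_le (hS : IsFiniteGenerating S) (n : ℕ) :
    {g : G | wordLength S g ≤ n}.Finite := by
  have key : ∀ n, {g : G | ∃ l : List G, l.length ≤ n ∧ (∀ s ∈ l, s ∈ S ∨ s⁻¹ ∈ S) ∧
      l.prod = g}.Finite := by
    intro n
    induction n with
    | zero =>
      refine (Set.finite_singleton 1).subset ?_
      rintro g ⟨l, hl, -, rfl⟩
      simp [List.length_eq_zero_iff.1 (Nat.le_zero.1 hl)]
    | succ n ih =>
      have hfin : ({1} ∪ Set.image2 (· * ·) (S ∪ S⁻¹) {g : G | ∃ l : List G, l.length ≤ n ∧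
          (∀ s ∈ l, s ∈ S ∨ s⁻¹ ∈ S) ∧ l.prod = g}).Finite :=
        (Set.finite_singleton 1).union
          (Set.Finite.image2 _ (hS.1.union (by simpa using hS.1)) ih)
      refine hfin.subset ?_
      rintro g ⟨l, hl, hlS, rfl⟩
      cases l with
      | nil => left; simp
      | cons s l =>
        right
        refine ⟨s, ?_, l.prod, ⟨l, by simpa using hl, fun x hx => hlS x (by simp [hx]), rfl⟩,
          by simp⟩
        simpa using hlS s (by simp)
  refine (key n).subset fun g hg => ?_
  obtain ⟨l, hl, hlS, hp⟩ := exists_list_length_eq_wordLength hS g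
  exact ⟨l, hl.trans_le hg, hlS, hp⟩

theorem abs_le_maxOnBall (hS : IsFiniteGenerating S) (h : G → ℝ) {n : ℕ} {g : G}
    (hg : wordLength S g ≤ n) : |h g| ≤ maxOnBall S h n :=
  le_csSup ((finite_setOf_wordLength_le hS n).image _).bddAbove ⟨g, hg, rfl⟩

theorem maxOnBall_nonneg (S : Set G) (h : G → ℝ) (n : ℕ) : 0 ≤ maxOnBall S h n :=
  Real.sSup_nonneg (by rintro _ ⟨x, -, rfl⟩; exact abs_nonneg _)

theorem HasSublinearGrowth.hasSubexponentialGrowth {h : G → ℝ} (hh : HasSublinearGrowth S h) :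
    HasSubexponentialGrowth S h := by
  intro c hc
  have h1 : Tendsto (fun n : ℕ => (n : ℝ) * Real.exp (-c * n)) atTop (𝓝 0) := by
    have := tendsto_self_mul_const_pow_of_lt_one (Real.exp_pos (-c)).le
      (Real.exp_lt_one_iff.2 (by linarith))
    refine this.congr fun n => ?_
    rw [← Real.exp_nat_mul, mul_comm (n : ℝ) (-c)]
  have h2 := h1.mul hh
  rw [zero_mul] at h2
  refine h2.congr' ?_
  filter_upwards [eventually_gt_atTop 0] with n hn
  have : (n : ℝ) ≠ 0 := by positivity
  field_simp

end WordLength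

/-! ### The lazy walk driven by an involution and a translation -/

section LazyWalk

variable {G : Type*} [Group G]

/-- The four steps `1, a, t, t⁻¹` of the lazy walk. -/
def lazyGen (a t : G) : Fin 4 → G := ![1, a, t, t⁻¹]

/-- The element of the group spelled by a word in the four letters `1, a, t, t⁻¹`. -/
def evalWord (a t : G) (w : List (Fin 4)) : G := (w.map (lazyGen a t)).prod

/-- The uniform measure on the steps `1, a, t, t⁻¹`, as the law of `lazyGen a t i` for `i`
uniform. -/
noncomputable def lazyMeasure (a t : G) : PMF G :=
  (PMF.uniformOfFintype (Fin 4)).map (lazyGen a t)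

@[simp] theorem evalWord_nil (a t : G) : evalWord a t [] = 1 := rfl

@[simp] theorem evalWord_cons (a t : G) (i : Fin 4) (w : List (Fin 4)) :
    evalWord a t (i :: w) = lazyGen a t i * evalWord a t w := by simp [evalWord]

@[simp] theorem evalWord_append (a t : G) (v w : List (Fin 4)) :
    evalWord a t (v ++ w) = evalWord a t v * evalWord a t w := by simp [evalWord]

theorem map_lazyGen {H : Type*} [Group H] (f : G →* H) (a t : G) (i : Fin 4) :
    f (lazyGen a t i) = lazyGen (f a) (f t) i := by
  fin_cases i <;> simp [lazyGen]

theorem map_evalWord {H : Type*} [Group H] (f : G →* H) (a t : G) (w : List (Fin 4)) :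
    f (evalWord a t w) = evalWord (f a) (f t) w := by
  induction w with
  | nil => simp
  | cons i w ih => simp [ih, map_lazyGen]

theorem exists_evalWord_eq {a t : G} (ha : a * a = 1)
    (hgen : Subgroup.closure {a, t} = ⊤) (g : G) : ∃ w, evalWord a t w = g := by
  have ha' : a⁻¹ = a := inv_eq_of_mul_eq_one_left ha
  obtain ⟨l, hl, rfl⟩ := exists_list_of_closure_eq_top hgen g
  induction l with
  | nil => exact ⟨[], rfl⟩
  | cons s l ih =>
    obtain ⟨w, hw⟩ := ih fun x hx => hl x (by simp [hx])
    have hs : ∃ i, lazyGen a t i = s := by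
      rcases hl s (by simp) with (h | h) | (h | h)
      · exact ⟨1, h.symm⟩
      · exact ⟨2, h.symm⟩
      · exact ⟨1, by rw [← inv_inv s, h, ha']; rfl⟩
      · exact ⟨3, by rw [← inv_inv s, Set.mem_singleton_iff.1 h]; rfl⟩
    obtain ⟨i, rfl⟩ := hs
    exact ⟨i :: w, by simp [hw]⟩

open scoped Classical in
theorem lazyMeasure_apply (a t g : G) :
    lazyMeasure a t g = ∑ i, if g = lazyGen a t i then (4⁻¹ : ℝ≥0∞) else 0 := by
  simp [lazyMeasure, PMF.map_apply, tsum_fintype]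

theorem support_lazyMeasure (a t : G) : (lazyMeasure a t).support = Set.range (lazyGen a t) := by
  simp [lazyMeasure, PMF.support_map]

theorem isSymmFiniteGenerating_lazyMeasure {a t : G} (ha : a * a = 1)
    (hgen : Subgroup.closure {a, t} = ⊤) : IsSymmFiniteGenerating (lazyMeasure a t) := by
  have ha' : a⁻¹ = a := inv_eq_of_mul_eq_one_left ha
  refine ⟨fun g => ?_, ?_, ?_⟩
  · classical
    have h : ∀ i, g⁻¹ = lazyGen a t i ↔ g = lazyGen a t (Equiv.swap 2 3 i) := by
      intro i
      rw [inv_eq_iff_eq_inv]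
      fin_cases i <;> simp [lazyGen, ha', Equiv.swap_apply_def]
    rw [lazyMeasure_apply, lazyMeasure_apply]
    exact Fintype.sum_equiv (Equiv.swap 2 3) _ _ fun i => if_congr (h i) rfl rfl
  · rw [support_lazyMeasure]; exact Set.finite_range _
  · rw [support_lazyMeasure, eq_top_iff, ← hgen]
    refine Subgroup.closure_mono ?_
    rintro x (rfl | rfl)
    exacts [⟨1, rfl⟩, ⟨2, rfl⟩]

/-- The Markov operator of the lazy walk. -/
noncomputable def lazyOp (a t : G) (φ : G → ℝ) (x : G) : ℝ :=
  (∑ i, φ (x * lazyGen a t i)) / 4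

theorem hasSum_mul_lazyMeasure (a t : G) (φ : G → ℝ) :
    HasSum (fun g => φ g * (lazyMeasure a t g).toReal) ((∑ i, φ (lazyGen a t i)) / 4) := by
  classical
  have h : ∀ g, φ g * (lazyMeasure a t g).toReal =
      ∑ i, if g = lazyGen a t i then φ (lazyGen a t i) / 4 else 0 := by
    intro g
    rw [lazyMeasure_apply, ENNReal.toReal_sum (by intro i _; split_ifs <;> simp), Finset.mul_sum]
    refine Finset.sum_congr rfl fun i _ => ?_
    split_ifs with hg
    · rw [hg]; simp [div_eq_mul_inv]
    · simp
  simp_rw [h, Finset.sum_div]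
  exact hasSum_sum fun i _ => hasSum_ite_eq (lazyGen a t i) _

theorem isHarmonic_lazyMeasure_iff {a t : G} {h : G → ℝ} :
    IsHarmonic (lazyMeasure a t) h ↔ ∀ x, lazyOp a t h x = h x := by
  simp only [IsHarmonic, lazyOp]
  exact forall_congr' fun x => by
    rw [(hasSum_mul_lazyMeasure a t fun g => h (x * g)).tsum_eq]

theorem finite_support_convPow (a t : G) (n : ℕ) :
    (convPow (lazyMeasure a t) n).support.Finite := by
  induction n with
  | zero => simp [convPow]
  | succ n ih =>
    rw [convPow, PMF.support_bind]
    refine ih.biUnion fun x _ => ?_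
    rw [PMF.support_map, support_lazyMeasure]
    exact (Set.finite_range _).image _

theorem exists_evalWord_of_mem_support_convPow {a t g : G} {n : ℕ}
    (hg : g ∈ (convPow (lazyMeasure a t) n).support) :
    ∃ w : List (Fin 4), w.length = n ∧ evalWord a t w = g := by
  induction n generalizing g with
  | zero => exact ⟨[], rfl, by simpa [convPow, eq_comm] using hg⟩
  | succ n ih =>
    rw [convPow, PMF.support_bind] at hg
    obtain ⟨x, hx, hg⟩ := Set.mem_iUnion₂.1 hg
    rw [PMF.support_map, support_lazyMeasure] at hg
    obtain ⟨_, ⟨i, rfl⟩, rfl⟩ := hg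
    obtain ⟨w, hw, rfl⟩ := ih hx
    exact ⟨w ++ [i], by simp [hw], by simp⟩

/-- The expectation of `φ (X_n)`. -/
noncomputable def walkMean (a t : G) (n : ℕ) (φ : G → ℝ) : ℝ :=
  ∑' x, (convPow (lazyMeasure a t) n x).toReal * φ x

theorem walkMean_eq_sum (a t : G) (n : ℕ) (φ : G → ℝ) :
    walkMean a t n φ = ∑ x ∈ (finite_support_convPow a t n).toFinset,
      (convPow (lazyMeasure a t) n x).toReal * φ x := by
  refine tsum_eq_sum fun x hx => ?_
  have : convPow (lazyMeasure a t) n x = 0 := by simpa [PMF.mem_support_iff] using hx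
  simp [this]

theorem walkMean_zero (a t : G) (φ : G → ℝ) : walkMean a t 0 φ = φ 1 := by
  classical
  rw [walkMean, tsum_eq_single 1]
  · simp [convPow]
  · intro x hx; simp [convPow, hx]

theorem walkMean_succ (a t : G) (n : ℕ) (φ : G → ℝ) :
    walkMean a t (n + 1) φ = walkMean a t n (lazyOp a t φ) := by
  classical
  set s := (finite_support_convPow a t n).toFinset
  have h : ∀ y, (convPow (lazyMeasure a t) (n + 1) y).toReal =
      ∑ x ∈ s, (convPow (lazyMeasure a t) n x).toReal *
        (lazyMeasure a t (x⁻¹ * y)).toReal := by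
    intro y
    have hy : convPow (lazyMeasure a t) (n + 1) y =
        ∑ x ∈ s, convPow (lazyMeasure a t) n x * lazyMeasure a t (x⁻¹ * y) := by
      rw [convPow, PMF.bind_apply, tsum_eq_sum (s := s)]
      · refine Finset.sum_congr rfl fun x _ => ?_
        rw [PMF.map_apply, tsum_eq_single (x⁻¹ * y)]
        · simp
        · intro z hz
          rw [if_neg]
          rintro rfl
          simp at hz
      · intro x hx
        have : convPow (lazyMeasure a t) n x = 0 := by
          simpa [s, PMF.mem_support_iff] using hx
        simp [this]
    rw [hy, ENNReal.toReal_sum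
      fun x _ => ENNReal.mul_ne_top (PMF.apply_ne_top _ _) (PMF.apply_ne_top _ _)]
    simp
  have hx : ∀ x, HasSum (fun y => (convPow (lazyMeasure a t) n x).toReal *
      (φ y * (lazyMeasure a t (x⁻¹ * y)).toReal))
      ((convPow (lazyMeasure a t) n x).toReal * lazyOp a t φ x) := by
    intro x
    refine HasSum.mul_left _ ?_
    rw [← (Equiv.mulLeft x).hasSum_iff]
    simp only [Function.comp_def, Equiv.coe_mulLeft, inv_mul_cancel_left, lazyOp]
    exact hasSum_mul_lazyMeasure a t fun g => φ (x * g)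
  rw [walkMean_eq_sum a t n, walkMean, ← (hasSum_sum fun x _ => hx x).tsum_eq]
  refine tsum_congr fun y => ?_
  rw [h, Finset.sum_mul]
  exact Finset.sum_congr rfl fun x _ => by ring

end LazyWalk

/-! ### Drift, Harnack inequality and finite normal subgroups -/

section LazyWalkGrowth

variable {G : Type*} [Group G] {a t : G}

theorem exists_wordLength_evalWord_le {S : Set G} (hS : IsFiniteGenerating S) (a t : G) :
    ∃ C : ℕ, ∀ w, wordLength S (evalWord a t w) ≤ C * w.length := by
  refine ⟨∑ i, wordLength S (lazyGen a t i), fun w => ?_⟩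
  induction w with
  | nil => simp [wordLength_one]
  | cons i w ih =>
    rw [evalWord_cons]
    refine (wordLength_mul_le hS _ _).trans ?_
    have := Finset.single_le_sum (f := fun i => wordLength S (lazyGen a t i))
      (fun i _ => Nat.zero_le _) (Finset.mem_univ i)
    rw [List.length_cons, mul_add, mul_one]
    omega

theorem abs_sub_le_of_evalWord {Ψ : G → ℝ} {L : ℝ}
    (hΨ : ∀ g i, |Ψ (g * lazyGen a t i) - Ψ g| ≤ L) (w : List (Fin 4)) (g : G) :
    |Ψ (g * evalWord a t w) - Ψ g| ≤ L * w.length := by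
  induction w generalizing g with
  | nil => simp
  | cons i w ih =>
    have h1 := ih (g * lazyGen a t i)
    have h2 := hΨ g i
    rw [evalWord_cons, ← mul_assoc, List.length_cons]
    push_cast
    calc _ ≤ _ := abs_sub_le _ (Ψ (g * lazyGen a t i)) _
      _ ≤ _ := by linarith

/-- A function that is Lipschitz along the steps of the walk is Lipschitz for every word length,
with a factor that depends on the generating set only. -/
theorem exists_abs_sub_le_mul_wordLength {S : Set G} (hS : IsFiniteGenerating S)
    (ha : a * a = 1) (hgen : Subgroup.closure {a, t} = ⊤) :
    ∃ C : ℕ, ∀ (Ψ : G → ℝ) (L : ℝ), (∀ g i, |Ψ (g * lazyGen a t i) - Ψ g| ≤ L) →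
      ∀ g, |Ψ g - Ψ 1| ≤ L * (C * wordLength S g) := by
  choose W hW using exists_evalWord_eq ha hgen
  have hfin : (S ∪ S⁻¹).Finite := hS.1.union (by simpa using hS.1)
  obtain ⟨C, hC⟩ := (hfin.image fun s => (W s).length).bddAbove
  refine ⟨C, fun Ψ L hΨ g => ?_⟩
  have hL : 0 ≤ L := (abs_nonneg _).trans (hΨ 1 0)
  obtain ⟨l, hl, hlS, rfl⟩ := exists_list_length_eq_wordLength hS g
  rw [← hl]
  have key : ∀ (l : List G), (∀ s ∈ l, s ∈ S ∨ s⁻¹ ∈ S) → ∀ g, |Ψ (g * l.prod) - Ψ g| ≤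
      L * (C * l.length) := by
    intro l
    induction l with
    | nil => intro _ g; simp
    | cons s l ih =>
      intro hs g
      have h1 := ih (fun x hx => hs x (by simp [hx])) (g * s)
      have h2 := abs_sub_le_of_evalWord hΨ (W s) g
      rw [hW] at h2
      have h3 : ((W s).length : ℝ) ≤ C := by
        exact_mod_cast hC ⟨s, by simpa using hs s (by simp), rfl⟩
      have h4 := mul_le_mul_of_nonneg_left h3 hL
      rw [List.prod_cons, ← mul_assoc, List.length_cons]
      push_cast
      calc _ ≤ _ := abs_sub_le _ (Ψ (g * s)) _
        _ ≤ _ := by linarith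
  simpa using key l hlS 1

theorem walkMean_mono {n : ℕ} {φ ψ : G → ℝ}
    (h : ∀ w : List (Fin 4), w.length = n → φ (evalWord a t w) ≤ ψ (evalWord a t w)) :
    walkMean a t n φ ≤ walkMean a t n ψ := by
  rw [walkMean_eq_sum, walkMean_eq_sum]
  refine Finset.sum_le_sum fun x hx => mul_le_mul_of_nonneg_left ?_ ENNReal.toReal_nonneg
  obtain ⟨w, hw, rfl⟩ := exists_evalWord_of_mem_support_convPow
    ((finite_support_convPow a t n).mem_toFinset.1 hx)
  exact h w hw

theorem walkMean_const_mul (n : ℕ) (c : ℝ) (φ : G → ℝ) :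
    walkMean a t n (fun x => c * φ x) = c * walkMean a t n φ := by
  simp only [walkMean, ← tsum_mul_left]
  exact tsum_congr fun x => by ring

theorem walkMean_add_const (n : ℕ) (c : ℝ) (φ : G → ℝ) :
    walkMean a t n (fun x => φ x + c) = walkMean a t n φ + c := by
  induction n generalizing φ with
  | zero => simp [walkMean_zero]
  | succ n ih =>
    rw [walkMean_succ, walkMean_succ, ← ih]
    congr 1
    ext x
    simp [lazyOp, Finset.sum_add_distrib, add_div]

/-- A function that increases by at least `c` on average at every point the walk can visit before
time `N` has mean at least `c * n` more at time `n ≤ N` than at the start. -/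
theorem add_mul_le_walkMean {φ : G → ℝ} {c : ℝ} {N : ℕ}
    (h : ∀ w : List (Fin 4), w.length < N →
      φ (evalWord a t w) + c ≤ lazyOp a t φ (evalWord a t w)) {n : ℕ} (hn : n ≤ N) :
    φ 1 + c * n ≤ walkMean a t n φ := by
  induction n with
  | zero => simp [walkMean_zero]
  | succ n ih =>
    rw [walkMean_succ]
    calc φ 1 + c * ((n + 1 : ℕ) : ℝ) = (φ 1 + c * n) + c := by push_cast; ring
      _ ≤ walkMean a t n φ + c := by linarith [ih (by omega)]
      _ = walkMean a t n fun x => φ x + c := (walkMean_add_const n c φ).symm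
      _ ≤ _ := walkMean_mono fun w hw => h w (by omega)

/-- Harnack inequality: the distance of a harmonic function to an upper bound grows at most by the
factor `4` per step. -/
theorem IsHarmonic.sub_le_four_pow_mul {v : G → ℝ} (hv : IsHarmonic (lazyMeasure a t) v) {M : ℝ}
    (w : List (Fin 4)) (g : G)
    (hM : ∀ u : List (Fin 4), u.length ≤ w.length → v (g * evalWord a t u) ≤ M) :
    M - v (g * evalWord a t w) ≤ 4 ^ w.length * (M - v g) := by
  induction w generalizing g with
  | nil => simp
  | cons i w ih =>
    have h1 := ih (g * lazyGen a t i) fun u hu => by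
      have := hM (i :: u) (by simpa using hu)
      rwa [evalWord_cons, ← mul_assoc] at this
    have h2 : M - v (g * lazyGen a t i) ≤ 4 * (M - v g) := by
      have h3 : ∀ j, 0 ≤ M - v (g * lazyGen a t j) := fun j => by
        have := hM [j] (by simp)
        simpa using this
      have h4 := Finset.single_le_sum (fun j _ => h3 j) (Finset.mem_univ i)
      have h5 := isHarmonic_lazyMeasure_iff.1 hv g
      rw [lazyOp, div_eq_iff (by norm_num)] at h5
      rw [Finset.sum_sub_distrib, h5] at h4
      simp at h4
      linarith
    rw [evalWord_cons, ← mul_assoc, List.length_cons, pow_succ, mul_assoc (4 ^ _)]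
    exact h1.trans (mul_le_mul_of_nonneg_left h2 (by positivity))

theorem IsHarmonic.comp_mul_left {h : G → ℝ} (hh : IsHarmonic (lazyMeasure a t) h) (k : G) :
    IsHarmonic (lazyMeasure a t) fun g => h (k * g) := by
  intro x
  simpa [mul_assoc] using hh (k * x)

theorem IsHarmonic.sub {h k : G → ℝ} (hh : IsHarmonic (lazyMeasure a t) h)
    (hk : IsHarmonic (lazyMeasure a t) k) :
    IsHarmonic (lazyMeasure a t) fun g => h g - k g := by
  rw [isHarmonic_lazyMeasure_iff] at *
  intro x
  rw [← hh x, ← hk x]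
  simp [lazyOp, Finset.sum_sub_distrib, sub_div]

/-- Left translation by an element of a finite normal subgroup does not increase a harmonic
function of sub-exponential growth. Within boundedly many steps, the walk from `g` reaches the point
`k ^ j * g` where the increment `v g = h (k * g) - h g` is nonpositive, so the supremum of `v` on a
ball is smaller, by a constant factor, than on a slightly larger ball. -/
theorem IsHarmonic.mul_left_le_of_mem {S : Set G} (hS : IsFiniteGenerating S) (ha : a * a = 1)
    (hgen : Subgroup.closure {a, t} = ⊤) {K : Subgroup G} [K.Normal] [Finite K] {h : G → ℝ}
    (hh : IsHarmonic (lazyMeasure a t) h) (hgrowth : HasSubexponentialGrowth S h) {k : G}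
    (hk : k ∈ K) (g : G) : h (k * g) ≤ h g := by
  obtain ⟨C, hC⟩ := exists_wordLength_evalWord_le hS a t
  choose W hW using exists_evalWord_eq ha hgen
  obtain ⟨m, hm⟩ := ((K : Set G).toFinite.image fun s => (W s).length).bddAbove
  set v : G → ℝ := fun g => h (k * g) - h g with hv
  have hvh : IsHarmonic (lazyMeasure a t) v := (hh.comp_mul_left k).sub hh
  have hkfin : IsOfFinOrder k :=
    K.subtype.isOfFinOrder (isOfFinOrder_of_finite (⟨k, hk⟩ : K))
  have hex : ∀ g, ∃ κ ∈ K, v (g * κ) ≤ 0 := by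
    intro g
    have hsum : ∑ j ∈ Finset.range (orderOf k), v (k ^ j * g) = 0 := by
      have := Finset.sum_range_sub (fun j => h (k ^ j * g)) (orderOf k)
      simp only [pow_orderOf_eq_one, pow_zero, sub_self] at this
      rw [← this]
      exact Finset.sum_congr rfl fun j _ => by simp [hv, pow_succ', mul_assoc]
    obtain ⟨j, -, hj⟩ := Finset.exists_le_of_sum_le (s := Finset.range (orderOf k))
      (f := fun j => v (k ^ j * g)) (g := fun _ => 0)
      ⟨0, Finset.mem_range.2 hkfin.orderOf_pos⟩ (by simp [hsum])
    refine ⟨g⁻¹ * k ^ j * g, ?_, by simpa [mul_assoc] using hj⟩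
    simpa using Subgroup.Normal.conj_mem ‹K.Normal› _ (K.pow_mem hk j) g⁻¹
  -- the summand `1` makes the radii below tend to infinity even if `C * m = 0`
  set D := C * m + 1
  set ε : ℝ := (4 ^ m)⁻¹ with hε
  have hε0 : 0 < ε := by positivity
  have hε1 : ε ≤ 1 := inv_le_one_of_one_le₀ (one_le_pow₀ (by norm_num))
  have hstep : ∀ (R : ℕ) (B : ℝ), 0 ≤ B → (∀ g, wordLength S g ≤ R + D → v g ≤ B) →
      ∀ g, wordLength S g ≤ R → v g ≤ (1 - ε) * B := by
    intro R B hB hvB g hg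
    obtain ⟨κ, hκ, hvκ⟩ := hex g
    have hlen : (W κ).length ≤ m := hm ⟨κ, hκ, rfl⟩
    have h1 := hvh.sub_le_four_pow_mul (M := B) (W κ) g fun u hu => by
      refine hvB _ ((wordLength_mul_le hS _ _).trans (add_le_add hg ((hC u).trans ?_)))
      exact (Nat.mul_le_mul_left C (hu.trans hlen)).trans (Nat.le_succ _)
    rw [hW] at h1
    have h0 : v g ≤ B := hvB g (by omega)
    have h2 : (4 : ℝ) ^ (W κ).length ≤ 4 ^ m := pow_le_pow_right₀ (by norm_num) hlen
    have h3 : B ≤ 4 ^ m * (B - v g) :=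
      (by linarith : B ≤ B - v (g * κ)).trans
        (h1.trans (mul_le_mul_of_nonneg_right h2 (by linarith)))
    have h4 : ε * B ≤ B - v g := by
      rw [hε, inv_mul_le_iff₀ (by positivity)]
      exact h3
    linarith
  have hiter : ∀ (j R : ℕ) (B : ℝ), 0 ≤ B → (∀ g, wordLength S g ≤ R + j * D → v g ≤ B) →
      ∀ g, wordLength S g ≤ R → v g ≤ (1 - ε) ^ j * B := by
    intro j
    induction j with
    | zero => intro R B _ hvB g hg; simpa using hvB g (by simpa using hg)
    | succ j ih =>
      intro R B hB hvB g hg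
      rw [pow_succ, mul_assoc]
      refine ih R _ (mul_nonneg (by linarith) hB) (hstep (R + j * D) B hB fun x hx => hvB x ?_) g hg
      rw [add_mul, one_mul]
      omega
  set R := wordLength S g + wordLength S k
  -- the growth rate `c` is chosen so that `exp (c * D) * (1 - ε) ≤ 1`
  set c : ℝ := ε / D with hc
  have hD0 : (0 : ℝ) < D := by positivity
  have hc0 : 0 < c := by positivity
  have hbound : ∀ j : ℕ, v g ≤ 2 * Real.exp (c * R) *
      (Real.exp (-c * (R + j * D : ℕ)) * maxOnBall S h (R + j * D)) := by
    intro j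
    have h1 := hiter j (wordLength S g) (2 * maxOnBall S h (R + j * D))
      (mul_nonneg two_pos.le (maxOnBall_nonneg _ _ _)) (fun x hx => by
        have hx1 : wordLength S x ≤ R + j * D := by omega
        have hx2 : wordLength S (k * x) ≤ R + j * D :=
          (wordLength_mul_le hS _ _).trans (by omega)
        have := abs_le.1 (abs_le_maxOnBall hS h hx1)
        have := abs_le.1 (abs_le_maxOnBall hS h hx2)
        simp only [hv]
        linarith) g le_rfl
    refine h1.trans ?_
    have h2 : (1 - ε) ^ j ≤ Real.exp (c * R) * Real.exp (-c * (R + j * D : ℕ)) := by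
      rw [← Real.exp_add]
      have h3 : c * R + -c * (R + j * D : ℕ) = j * (-ε) := by
        push_cast
        rw [hc]
        field_simp
        ring
      rw [h3, Real.exp_nat_mul]
      exact pow_le_pow_left₀ (by linarith) (by linarith [Real.add_one_le_exp (-ε)]) _
    have := mul_le_mul_of_nonneg_right h2
      (mul_nonneg two_pos.le (maxOnBall_nonneg S h (R + j * D)))
    linarith
  have hlim : Tendsto (fun j : ℕ => R + j * D) atTop atTop := by
    refine tendsto_atTop_mono (fun j => ?_) tendsto_id
    simp only [id, D]
    nlinarith [Nat.zero_le (j * (C * m))]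
  have := ge_of_tendsto' (((hgrowth c hc0).comp hlim).const_mul (2 * Real.exp (c * R))) hbound
  rw [mul_zero] at this
  simp only [hv] at this
  linarith

theorem IsHarmonic.mul_left_eq_of_mem {S : Set G} (hS : IsFiniteGenerating S) (ha : a * a = 1)
    (hgen : Subgroup.closure {a, t} = ⊤) {K : Subgroup G} [K.Normal] [Finite K] {h : G → ℝ}
    (hh : IsHarmonic (lazyMeasure a t) h) (hgrowth : HasSubexponentialGrowth S h) {k : G}
    (hk : k ∈ K) (g : G) : h (k * g) = h g := by
  refine le_antisymm (hh.mul_left_le_of_mem hS ha hgen hgrowth hk g) ?_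
  simpa using hh.mul_left_le_of_mem hS ha hgen hgrowth (K.inv_mem hk) (k * g)

end LazyWalkGrowth

/-! ### The lamplighter group `ℤˣ ≀ ℤ` -/

section Lamplighter

/-- The element of `ℤˣ ≀ ℤ` with finitely supported lamps `φ` and cursor at `z`. -/
def lampElt (φ : ℤ → ℤˣ) (hφ : (Function.mulSupport φ).Finite) (z : ℤ) : lamplighter ℤˣ :=
  ⟨⟨fun x => φ x.toAdd, Multiplicative.ofAdd z⟩, hφ.preimage Multiplicative.toAdd.injective.injOn⟩

theorem finite_mulSupport_mulSingle (x : ℤ) :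
    (Function.mulSupport (Pi.mulSingle x (-1) : ℤ → ℤˣ)).Finite :=
  (Set.finite_singleton x).subset Pi.mulSupport_mulSingle_subset

theorem finite_mulSupport_mul_mulSingle {φ : ℤ → ℤˣ} (hφ : (Function.mulSupport φ).Finite)
    (x : ℤ) : (Function.mulSupport (φ * Pi.mulSingle x (-1))).Finite :=
  (hφ.union (finite_mulSupport_mulSingle x)).subset (Function.mulSupport_mul _ _)

/-- Switching the lamp at the cursor position `0`. -/
def lampSwitch : lamplighter ℤˣ :=
  lampElt (Pi.mulSingle 0 (-1)) (finite_mulSupport_mulSingle 0) 0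

/-- Moving the cursor by one. -/
def lampShift : lamplighter ℤˣ := lampElt 1 (by simp) 1

theorem exists_lampElt_eq (q : lamplighter ℤˣ) : ∃ φ hφ z, q = lampElt φ hφ z :=
  ⟨fun x => q.1.left (Multiplicative.ofAdd x), q.2.preimage Multiplicative.ofAdd.injective.injOn,
    q.1.right.toAdd, rfl⟩

theorem lampElt_mul {φ ψ : ℤ → ℤˣ} (hφ : (Function.mulSupport φ).Finite)
    (hψ : (Function.mulSupport ψ).Finite) (y z : ℤ) {χ : ℤ → ℤˣ}
    (hχ : (Function.mulSupport χ).Finite) (h : ∀ x, χ x = φ x * ψ (x - y)) :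
    lampElt φ hφ y * lampElt ψ hψ z = lampElt χ hχ (y + z) := by
  refine Subtype.ext (RegularWreathProduct.ext ?_ ?_)
  · funext x
    simp [lampElt, h, sub_eq_neg_add]
  · simp [lampElt]

theorem lampElt_congr {φ ψ : ℤ → ℤˣ} {hφ : (Function.mulSupport φ).Finite}
    {hψ : (Function.mulSupport ψ).Finite} {y z : ℤ} (h : φ = ψ) (hz : y = z) :
    lampElt φ hφ y = lampElt ψ hψ z := by
  subst h; subst hz; rfl

theorem lampElt_inj {φ ψ : ℤ → ℤˣ} {hφ : (Function.mulSupport φ).Finite}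
    {hψ : (Function.mulSupport ψ).Finite} {y z : ℤ} (h : lampElt φ hφ y = lampElt ψ hψ z) :
    φ = ψ ∧ y = z := by
  have h1 := congrArg Subtype.val h
  exact ⟨funext fun x => congrFun (congrArg RegularWreathProduct.left h1) (Multiplicative.ofAdd x),
    congrArg RegularWreathProduct.right h1⟩

theorem lampElt_one : lampElt 1 (by simp) 0 = 1 := rfl

theorem lampElt_mul_shift (φ : ℤ → ℤˣ) (hφ) (z : ℤ) :
    lampElt φ hφ z * lampShift = lampElt φ hφ (z + 1) :=
  lampElt_mul _ _ _ _ _ (by simp)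

theorem lampElt_mul_shift_inv (φ : ℤ → ℤˣ) (hφ) (z : ℤ) :
    lampElt φ hφ z * lampShift⁻¹ = lampElt φ hφ (z - 1) := by
  rw [mul_inv_eq_iff_eq_mul, lampElt_mul_shift]
  exact lampElt_congr rfl (by ring)

theorem lampElt_mul_switch (φ : ℤ → ℤˣ) (hφ) (z : ℤ) :
    lampElt φ hφ z * lampSwitch =
      lampElt (φ * Pi.mulSingle z (-1)) (finite_mulSupport_mul_mulSingle hφ z) z := by
  refine (lampElt_mul _ _ _ _ (finite_mulSupport_mul_mulSingle hφ z) ?_).trans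
    (lampElt_congr rfl (by simp))
  intro x
  simp [Pi.mulSingle_apply, sub_eq_zero]

theorem lampSwitch_mul_self : lampSwitch * lampSwitch = 1 := by
  rw [← lampElt_one]
  refine lampElt_mul _ _ _ _ _ fun x => ?_
  simp [Pi.mulSingle_apply]
  split_ifs <;> simp

/-- Switching the lamp at position `x`, acting on the left. -/
theorem lampElt_mulSingle_mul (x : ℤ) (φ : ℤ → ℤˣ) (hφ) (z : ℤ) :
    lampElt (Pi.mulSingle x (-1)) (finite_mulSupport_mulSingle x) 0 * lampElt φ hφ z =
      lampElt (φ * Pi.mulSingle x (-1)) (finite_mulSupport_mul_mulSingle hφ x) z := by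
  refine (lampElt_mul _ _ _ _ (finite_mulSupport_mul_mulSingle hφ x) ?_).trans
    (lampElt_congr rfl (by simp))
  intro y
  simp [mul_comm]

theorem evalWord_replicate_shift (n : ℕ) (φ : ℤ → ℤˣ) (hφ) (z : ℤ) :
    lampElt φ hφ z * evalWord lampSwitch lampShift (List.replicate n 3) =
      lampElt φ hφ (z - n) := by
  induction n generalizing z with
  | zero => simp
  | succ n ih =>
    rw [List.replicate_succ, evalWord_cons, ← mul_assoc]
    change lampElt φ hφ z * lampShift⁻¹ * _ = _
    rw [lampElt_mul_shift_inv, ih]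
    exact lampElt_congr rfl (by push_cast; ring)

/-- The lamps on an interval of length `n` starting at `-R` are set in one sweep. -/
theorem exists_evalWord_sweep (R n : ℕ) (φ : ℤ → ℤˣ) (hφ : (Function.mulSupport φ).Finite)
    (h : ∀ x, φ x ≠ 1 → -(R : ℤ) ≤ x ∧ x < -R + n) :
    ∃ w : List (Fin 4), w.length ≤ R + 2 * n ∧
      evalWord lampSwitch lampShift w = lampElt φ hφ (-R + n) := by
  induction n generalizing φ with
  | zero =>
    refine ⟨List.replicate R 3, by simp, ?_⟩
    have h1 := evalWord_replicate_shift R 1 (by simp) 0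
    rw [lampElt_one, one_mul] at h1
    rw [h1]
    refine lampElt_congr ?_ (by simp)
    funext x
    by_contra hx
    have := h x (fun h' => hx h'.symm)
    simp at this
    omega
  | succ n ih =>
    by_cases hlast : φ (-R + n) = 1
    · obtain ⟨w, hw, he⟩ := ih φ hφ fun x hx => by
        have h1 := h x hx
        have h2 : x ≠ -R + n := fun h' => hx (h' ▸ hlast)
        push_cast at h1
        omega
      refine ⟨w ++ [2], by simp; omega, ?_⟩
      rw [evalWord_append, he, evalWord_cons, evalWord_nil, mul_one]
      change _ * lampShift = _
      rw [lampElt_mul_shift]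
      exact lampElt_congr rfl (by push_cast; ring)
    · have hlast' : φ (-R + n) = -1 := (Int.units_eq_one_or _).resolve_left hlast
      obtain ⟨w, hw, he⟩ := ih (φ * Pi.mulSingle (-R + n : ℤ) (-1))
        (finite_mulSupport_mul_mulSingle hφ _) fun x hx => by
          by_cases h2 : x = -R + n
          · subst h2
            simp [hlast'] at hx
          · have h1 := h x (by simpa [Pi.mulSingle_apply, h2] using hx)
            push_cast at h1
            omega
      refine ⟨w ++ [1, 2], by simp; omega, ?_⟩
      rw [evalWord_append, he, evalWord_cons, evalWord_cons, evalWord_nil, mul_one, ← mul_assoc]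
      change _ * lampSwitch * lampShift = _
      rw [lampElt_mul_switch, lampElt_mul_shift]
      refine lampElt_congr ?_ (by push_cast; ring)
      funext x
      simp only [Pi.mul_apply, Pi.mulSingle_apply]
      split_ifs <;> simp

/-- An element with lamps and cursor in `[-R, R]` is spelled by a word of length at most
`7 R + 3`. -/
theorem exists_evalWord_lampElt (R : ℕ) (φ : ℤ → ℤˣ) (hφ : (Function.mulSupport φ).Finite) (z : ℤ)
    (h : ∀ x, φ x ≠ 1 → -(R : ℤ) ≤ x ∧ x ≤ R) (hz : -(R : ℤ) ≤ z ∧ z ≤ R) :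
    ∃ w : List (Fin 4), w.length ≤ 7 * R + 3 ∧
      evalWord lampSwitch lampShift w = lampElt φ hφ z := by
  obtain ⟨w, hw, he⟩ := exists_evalWord_sweep R (2 * R + 1) φ hφ fun x hx => by
    have := h x hx
    push_cast
    omega
  refine ⟨w ++ List.replicate (R + 1 - z).toNat 3, by simp; omega, ?_⟩
  rw [evalWord_append, he, evalWord_replicate_shift]
  refine lampElt_congr rfl ?_
  push_cast
  omega

theorem exists_window {φ : ℤ → ℤˣ} (hφ : (Function.mulSupport φ).Finite) (z : ℤ) :
    ∃ R : ℕ, (∀ x, φ x ≠ 1 → -(R : ℤ) ≤ x ∧ x ≤ R) ∧ -(R : ℤ) ≤ z ∧ z ≤ R := by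
  obtain ⟨B, hB⟩ := ((hφ.union (Set.finite_singleton z)).image Int.natAbs).bddAbove
  have hB' : ∀ x, φ x ≠ 1 ∨ x = z → x.natAbs ≤ B := fun x hx => hB ⟨x, hx, rfl⟩
  refine ⟨B, fun x hx => ?_, ?_⟩
  · have := hB' x (Or.inl hx); omega
  · have := hB' z (Or.inr rfl); omega

theorem exists_evalWord_lamplighter (q : lamplighter ℤˣ) :
    ∃ w, evalWord lampSwitch lampShift w = q := by
  obtain ⟨φ, hφ, z, rfl⟩ := exists_lampElt_eq q
  obtain ⟨R, h1, h2⟩ := exists_window hφ z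
  obtain ⟨w, -, hw⟩ := exists_evalWord_lampElt R φ hφ z h1 h2
  exact ⟨w, hw⟩

end Lamplighter

/-! ### Sublinear harmonic functions on `ℤˣ ≀ ℤ` -/

section LamplighterHarmonic

/-- For a sequence that is convex up to `R` with `V 0 ≤ V 1 / 2`, the quotients `V n / (n + 1)` are
nondecreasing up to `R`. -/
theorem mul_le_mul_of_convex_of_le_half {V : ℕ → ℝ} {R : ℕ} (h0 : V 0 ≤ V 1 / 2)
    (hconv : ∀ n, n + 1 < R → V (n + 1) ≤ (V n + V (n + 2)) / 2) {n : ℕ} (hn : n ≤ R) :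
    V n * (R + 1) ≤ V R * (n + 1) := by
  have hratio : ∀ n, n < R → V n * (n + 2) ≤ V (n + 1) * (n + 1) := by
    intro n
    induction n with
    | zero => intro _; simp; linarith
    | succ n ih =>
      intro hn
      have h1 := ih (by omega)
      have h2 := hconv n hn
      have h3 := mul_le_mul_of_nonneg_right h2 (by positivity : (0 : ℝ) ≤ n + 2)
      have : n + 1 + 1 = n + 2 := rfl
      push_cast
      rw [this]
      nlinarith
  obtain ⟨j, rfl⟩ := Nat.exists_eq_add_of_le hn
  clear hconv
  induction j with
  | zero => simp
  | succ j ih =>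
    have h1 := ih (by omega) fun i hi => hratio i (by omega)
    have h2 := hratio (n + j) (by omega)
    have h3 := mul_le_mul_of_nonneg_right h1 (by positivity : (0 : ℝ) ≤ n + j + 2)
    have h4 := mul_le_mul_of_nonneg_right h2 (by positivity : (0 : ℝ) ≤ n + 1)
    refine le_of_mul_le_mul_right ?_ (by positivity : (0 : ℝ) < n + j + 1)
    rw [← add_assoc]
    push_cast at *
    linarith

variable {k : lamplighter ℤˣ → ℝ}

theorem IsHarmonic.lampElt_eq (hk : IsHarmonic (lazyMeasure lampSwitch lampShift) k)
    (φ : ℤ → ℤˣ) (hφ) (z : ℤ) :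
    4 * k (lampElt φ hφ z) = k (lampElt φ hφ z) +
      k (lampElt (φ * Pi.mulSingle z (-1)) (finite_mulSupport_mul_mulSingle hφ z) z) +
      k (lampElt φ hφ (z + 1)) + k (lampElt φ hφ (z - 1)) := by
  have h := isHarmonic_lazyMeasure_iff.1 hk (lampElt φ hφ z)
  rw [lazyOp, div_eq_iff (by norm_num), Fin.sum_univ_four] at h
  simp only [lazyGen, Matrix.cons_val, mul_one, lampElt_mul_switch, lampElt_mul_shift,
    lampElt_mul_shift_inv] at h
  linarith

/-- Lamp configurations supported in `[-R, R]`. -/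
abbrev WindowLamps (R : ℕ) : Type := {φ : ℤ → ℤˣ // ∀ x, φ x ≠ 1 → -(R : ℤ) ≤ x ∧ x ≤ R}

theorem WindowLamps.finite_mulSupport {R : ℕ} (φ : WindowLamps R) :
    (Function.mulSupport φ.1).Finite :=
  (Set.finite_Icc (-(R : ℤ)) R).subset fun x hx => φ.2 x hx

/-- The configuration `φ` with the lamp at `x` switched. -/
def WindowLamps.switch {R : ℕ} (φ : WindowLamps R) {x : ℤ} (hx : -(R : ℤ) ≤ x ∧ x ≤ R) :
    WindowLamps R :=
  ⟨φ.1 * Pi.mulSingle x (-1), fun y hy => by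
    by_cases h : y = x
    · exact h ▸ hx
    · exact φ.2 y (by simpa [Pi.mulSingle_apply, h] using hy)⟩

/-- The increment of a harmonic function under switching the lamp at `x` from the left is odd under
that switch, so at the cursor position `x` the lazy walk averages it with its negative. Along the
cursor, this forces at least linear growth with a slope proportional to its size. -/
theorem IsHarmonic.abs_lamp_increment_mul_le (hk : IsHarmonic (lazyMeasure lampSwitch lampShift) k)
    {x : ℤ} {R R' : ℕ} (hR : R + x.natAbs ≤ R') {M : ℝ}
    (hM : ∀ (φ : WindowLamps R') (z : ℤ), -(R' : ℤ) ≤ z ∧ z ≤ R' →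
      |k (lampElt φ.1 φ.finite_mulSupport z)| ≤ M)
    (φ : WindowLamps R') {z : ℤ} (hz : (z - x).natAbs ≤ R) :
    |k (lampElt (φ.1 * Pi.mulSingle x (-1))
        (finite_mulSupport_mul_mulSingle φ.finite_mulSupport x) z) -
      k (lampElt φ.1 φ.finite_mulSupport z)| * (R + 1) ≤ 4 * M * ((z - x).natAbs + 1) := by
  have hx : -(R' : ℤ) ≤ x ∧ x ≤ R' := by omega
  set v : lamplighter ℤˣ → ℝ := fun q =>
    k (lampElt (Pi.mulSingle x (-1)) (finite_mulSupport_mulSingle x) 0 * q) - k q with hv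
  have hvh : IsHarmonic (lazyMeasure lampSwitch lampShift) v := (hk.comp_mul_left _).sub hk
  set u : WindowLamps R' → ℤ → ℝ := fun φ z => v (lampElt φ.1 φ.finite_mulSupport z) with hu
  have huk : ∀ φ z, u φ z = k (lampElt (φ.1 * Pi.mulSingle x (-1))
      (finite_mulSupport_mul_mulSingle φ.finite_mulSupport x) z) -
      k (lampElt φ.1 φ.finite_mulSupport z) := fun φ z => by
    simp only [hu, hv, lampElt_mulSingle_mul]
  have hharm : ∀ φ z (hz : -(R' : ℤ) ≤ z ∧ z ≤ R'),
      4 * u φ z = u φ z + u (φ.switch hz) z + u φ (z + 1) + u φ (z - 1) :=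
    fun φ z hz => hvh.lampElt_eq φ.1 φ.finite_mulSupport z
  have hodd : ∀ φ z, u (φ.switch hx) z = - u φ z := by
    intro φ z
    have h1 : ((φ.switch hx).1 * Pi.mulSingle x (-1)) = φ.1 := by
      funext y
      simp only [WindowLamps.switch, Pi.mul_apply, Pi.mulSingle_apply]
      split_ifs <;> simp
    rw [huk, huk, neg_sub]
    exact congrArg₂ _ (congrArg k (lampElt_congr h1 rfl)) rfl
  have hbd : ∀ φ z, (-(R' : ℤ) ≤ z ∧ z ≤ R') → |u φ z| ≤ 2 * M := by
    intro φ z hz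
    rw [huk]
    have h1 := hM (φ.switch hx) z hz
    have h2 := hM φ z hz
    exact (abs_sub _ _).trans (by rw [two_mul]; exact add_le_add h1 h2)
  set U : ℤ → ℝ := fun z => ⨆ φ, |u φ z| with hU
  have : Nonempty (WindowLamps R') := ⟨φ⟩
  have hle : ∀ φ z, (-(R' : ℤ) ≤ z ∧ z ≤ R') → |u φ z| ≤ U z := fun φ z hz =>
    le_ciSup (f := fun φ => |u φ z|) ⟨2 * M, by rintro _ ⟨φ, rfl⟩; exact hbd φ z hz⟩ φ
  have hU0 : ∀ z, 0 ≤ U z := fun z => Real.iSup_nonneg fun φ => abs_nonneg _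
  have hUM : ∀ z, (-(R' : ℤ) ≤ z ∧ z ≤ R') → U z ≤ 2 * M := fun z hz =>
    ciSup_le fun φ => hbd φ z hz
  have hUconv : ∀ z, (-(R' : ℤ) ≤ z - 1 ∧ z + 1 ≤ R') → U z ≤ (U (z + 1) + U (z - 1)) / 2 := by
    intro z hz
    have : U z ≤ (2 * U z + U (z + 1) + U (z - 1)) / 4 := ciSup_le fun φ => by
      have hz' : -(R' : ℤ) ≤ z ∧ z ≤ R' := by omega
      have h0 := hharm φ z hz'
      have h1 := abs_le.1 (hle φ z hz')
      have h2 := abs_le.1 (hle (φ.switch hz') z hz')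
      have h3 := abs_le.1 (hle φ (z + 1) (by omega))
      have h4 := abs_le.1 (hle φ (z - 1) (by omega))
      rw [abs_le]
      constructor <;> linarith
    linarith
  have hUx : (-(R' : ℤ) ≤ x - 1 ∧ x + 1 ≤ R') → U x ≤ (U (x + 1) + U (x - 1)) / 4 := by
    intro hx'
    refine ciSup_le fun φ => ?_
    have h0 := hharm φ x hx
    have h2 := hodd φ x
    have h3 := abs_le.1 (hle φ (x + 1) (by omega))
    have h4 := abs_le.1 (hle φ (x - 1) (by omega))
    rw [abs_le]
    constructor <;> linarith
  rw [← huk]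
  set n := (z - x).natAbs with hn
  -- symmetrizing around `x` turns the two-sided problem into one on `ℕ`
  set V : ℕ → ℝ := fun n => U (x + n) + U (x - n) with hV
  have hzV : |u φ z| ≤ V n := by
    rcases le_total 0 (z - x) with h | h
    · have : z = x + n := by omega
      calc |u φ z| ≤ U z := hle φ z (by omega)
        _ = U (x + n) := by rw [← this]
        _ ≤ V n := le_add_of_nonneg_right (hU0 _)
    · have : z = x - n := by omega
      calc |u φ z| ≤ U z := hle φ z (by omega)
        _ = U (x - n) := by rw [← this]
        _ ≤ V n := le_add_of_nonneg_left (hU0 _)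
  have hVR : V R ≤ 4 * M := by
    have h1 := hUM (x + R) (by omega)
    have h2 := hUM (x - R) (by omega)
    simp only [hV]
    linarith
  rcases Nat.eq_zero_or_pos R with rfl | hRpos
  · have : n = 0 := by omega
    rw [this] at hzV ⊢
    push_cast at hVR ⊢
    linarith
  · have := mul_le_mul_of_convex_of_le_half (V := V) (R := R) (by
      have := hUx (by omega)
      simp only [hV]
      push_cast
      rw [add_zero, sub_zero]
      linarith) (fun j hj => by
      have h1 := hUconv (x + (j + 1 : ℕ)) (by push_cast; omega)
      have h2 := hUconv (x - (j + 1 : ℕ)) (by push_cast; omega)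
      simp only [hV]
      rw [show x + (j + 1 : ℕ) + 1 = x + (j + 2 : ℕ) by push_cast; ring,
        show x + (j + 1 : ℕ) - 1 = x + j by push_cast; ring] at h1
      rw [show x - (j + 1 : ℕ) + 1 = x - j by push_cast; ring,
        show x - (j + 1 : ℕ) - 1 = x - (j + 2 : ℕ) by push_cast; ring] at h2
      linarith) (n := n) hz
    calc |u φ z| * (R + 1) ≤ V n * (R + 1) :=
          mul_le_mul_of_nonneg_right hzV (by positivity)
      _ ≤ V R * (n + 1) := this
      _ ≤ 4 * M * (n + 1) := mul_le_mul_of_nonneg_right hVR (by positivity)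

/-- A sublinear harmonic function does not change when a lamp is switched from the left. Here `m n`
bounds `|k|` on the elements spelled by words of length at most `n`. -/
theorem IsHarmonic.lamp_switch_eq (hk : IsHarmonic (lazyMeasure lampSwitch lampShift) k)
    {m : ℕ → ℝ}
    (hm : ∀ n w, w.length ≤ n → |k (evalWord lampSwitch lampShift w)| ≤ m n)
    (hlim : Tendsto (fun n : ℕ => m n / n) atTop (𝓝 0)) (x : ℤ) (φ : ℤ → ℤˣ) (hφ) (z : ℤ) :
    k (lampElt (φ * Pi.mulSingle x (-1)) (finite_mulSupport_mul_mulSingle hφ x) z) =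
      k (lampElt φ hφ z) := by
  obtain ⟨R₀, hR₀, -⟩ := exists_window hφ z
  set c := x.natAbs + R₀
  set d := (z - x).natAbs
  have hbound : ∀ᶠ R : ℕ in atTop,
      |k (lampElt (φ * Pi.mulSingle x (-1)) (finite_mulSupport_mul_mulSingle hφ x) z) -
        k (lampElt φ hφ z)| ≤
      (m (7 * (R + c) + 3) / (7 * (R + c) + 3 : ℕ)) * (4 * (7 * c + 7) * (d + 1)) := by
    filter_upwards [eventually_ge_atTop d] with R hR
    have h := hk.abs_lamp_increment_mul_le (x := x) (R := R) (R' := R + c) (by omega)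
      (M := m (7 * (R + c) + 3)) (fun ψ y hy => by
        obtain ⟨w, hw, he⟩ := exists_evalWord_lampElt (R + c) ψ.1 ψ.finite_mulSupport y ψ.2 hy
        rw [← he]
        exact hm _ w hw) ⟨φ, fun y hy => by have := hR₀ y hy; omega⟩ (z := z) hR
    rw [← le_div_iff₀ (by positivity)] at h
    refine h.trans ?_
    have hm0 : 0 ≤ m (7 * (R + c) + 3) := (abs_nonneg _).trans (hm _ [] (by simp))
    have h7 : ((7 * (R + c) + 3 : ℕ) : ℝ) ≤ (7 * c + 7) * (R + 1) := by
      push_cast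
      nlinarith [(Nat.cast_nonneg R : (0 : ℝ) ≤ R), (Nat.cast_nonneg c : (0 : ℝ) ≤ c),
        mul_nonneg (Nat.cast_nonneg R : (0 : ℝ) ≤ R) (Nat.cast_nonneg c : (0 : ℝ) ≤ c)]
    have hpos : (0 : ℝ) < ((7 * (R + c) + 3 : ℕ) : ℝ) := by positivity
    rw [div_mul_eq_mul_div, div_le_div_iff₀ (by positivity) hpos]
    have h8 := mul_le_mul_of_nonneg_left h7
      (by positivity : 0 ≤ 4 * m (7 * (R + c) + 3) * ((d : ℝ) + 1))
    linarith
  have hlim' : Tendsto (fun R : ℕ => (m (7 * (R + c) + 3) / (7 * (R + c) + 3 : ℕ)) *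
      (4 * (7 * c + 7) * (d + 1) : ℝ)) atTop (𝓝 0) := by
    have h1 : Tendsto (fun R : ℕ => 7 * (R + c) + 3) atTop atTop :=
      tendsto_atTop_mono (fun R => by simp only [id]; omega) tendsto_id
    simpa using (hlim.comp h1).mul_const (4 * (7 * c + 7) * (d + 1) : ℝ)
  have := ge_of_tendsto hlim' hbound
  exact sub_eq_zero.1 (abs_eq_zero.1 (le_antisymm this (abs_nonneg _)))

theorem eq_of_lamp_switch_eq
    (h : ∀ (x : ℤ) (φ : ℤ → ℤˣ) (hφ) (z : ℤ),
      k (lampElt (φ * Pi.mulSingle x (-1)) (finite_mulSupport_mul_mulSingle hφ x) z) =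
        k (lampElt φ hφ z)) (φ : ℤ → ℤˣ) (hφ) (z : ℤ) :
    k (lampElt φ hφ z) = k (lampElt 1 (by simp) z) := by
  have key : ∀ (s : Finset ℤ) (φ : ℤ → ℤˣ) (hφ), (∀ x, φ x ≠ 1 → x ∈ s) →
      k (lampElt φ hφ z) = k (lampElt 1 (by simp) z) := by
    intro s
    induction s using Finset.induction_on with
    | empty =>
      intro φ hφ hs
      refine congrArg k (lampElt_congr (funext fun x => ?_) rfl)
      by_contra hx
      simpa using hs x hx
    | insert x s _ ih =>
      intro φ hφ hs
      by_cases hx : φ x = 1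
      · refine ih φ hφ fun y hy => ?_
        rcases Finset.mem_insert.1 (hs y hy) with rfl | h'
        exacts [absurd hx hy, h']
      · rw [← h x φ hφ z]
        refine ih _ _ fun y hy => ?_
        by_cases hyx : y = x
        · subst hyx
          simp [(Int.units_eq_one_or _).resolve_left hx] at hy
        · have hy' := hs y (by simpa [Pi.mulSingle_apply, hyx] using hy)
          exact (Finset.mem_insert.1 hy').resolve_left hyx
  exact key hφ.toFinset φ hφ fun x hx => by simpa using hx

/-- A sublinear harmonic function on `ℤˣ ≀ ℤ` is constant. -/
theorem IsHarmonic.eq_of_sublinear_lamplighter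
    (hk : IsHarmonic (lazyMeasure lampSwitch lampShift) k) {m : ℕ → ℝ}
    (hm : ∀ n w, w.length ≤ n → |k (evalWord lampSwitch lampShift w)| ≤ m n)
    (hlim : Tendsto (fun n : ℕ => m n / n) atTop (𝓝 0)) (q : lamplighter ℤˣ) : k q = k 1 := by
  have hlamp := eq_of_lamp_switch_eq (hk.lamp_switch_eq hm hlim)
  set H : ℤ → ℝ := fun z => k (lampElt 1 (by simp) z) with hH
  have hHh : ∀ z, H (z + 1) - H z = H z - H (z - 1) := by
    intro z
    have h := hk.lampElt_eq 1 (by simp) z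
    rw [hlamp (1 * Pi.mulSingle z (-1))] at h
    simp only [hH]
    linarith
  set d := H 0 - H (-1) with hd
  have hslope : ∀ n : ℕ, H (-n) - H (-n - 1) = d := by
    intro n
    induction n with
    | zero => simp [hd]
    | succ n ih =>
      have := hHh (-n - 1)
      rw [show (-n - 1 + 1 : ℤ) = -n by ring] at this
      push_cast
      rw [neg_add, ← sub_eq_add_neg]
      linarith
  have hneg : ∀ n : ℕ, H (-n) = H 0 - n * d := by
    intro n
    induction n with
    | zero => simp
    | succ n ih =>
      have := hslope n
      push_cast
      rw [neg_add, ← sub_eq_add_neg]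
      linarith
  have hd0 : d = 0 := by
    have hb : ∀ᶠ n : ℕ in atTop, |d| ≤ m n / n + |H 0| / n := by
      filter_upwards [eventually_gt_atTop 0] with n hn
      have hn' : (0 : ℝ) < n := by exact_mod_cast hn
      have h1 := evalWord_replicate_shift n 1 (by simp) 0
      rw [lampElt_one, one_mul, zero_sub] at h1
      have h2 := hm n (List.replicate n 3) (by simp)
      rw [h1] at h2
      have h3 : |H (-n)| ≤ m n := h2
      rw [hneg] at h3
      rw [← add_div, le_div_iff₀ hn']
      have h4 : |d| * n = |n * d| := by rw [abs_mul, Nat.abs_cast, mul_comm]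
      have h5 := abs_sub_abs_le_abs_sub ((n : ℝ) * d) (H 0)
      rw [abs_sub_comm] at h5
      linarith
    have hl : Tendsto (fun n : ℕ => m n / n + |H 0| / n) atTop (𝓝 0) := by
      simpa using hlim.add (tendsto_const_div_atTop_nhds_zero_nat |H 0|)
    exact abs_eq_zero.1 (le_antisymm (ge_of_tendsto hl hb) (abs_nonneg _))
  have hpos : ∀ n : ℕ, H (n + 1) - H n = 0 := by
    intro n
    induction n with
    | zero =>
      have := hHh 0
      simp only [zero_sub, zero_add] at this
      push_cast
      linarith
    | succ n ih =>
      have := hHh (n + 1)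
      rw [add_sub_cancel_right] at this
      push_cast
      linarith
  have hHc : ∀ z, H z = H 0 := by
    intro z
    obtain ⟨n, rfl | rfl⟩ := z.eq_nat_or_neg
    · induction n with
      | zero => simp
      | succ n ih =>
        have := hpos n
        push_cast
        linarith
    · rw [hneg, hd0, mul_zero, sub_zero]
  obtain ⟨φ, hφ, z, rfl⟩ := exists_lampElt_eq q
  rw [hlamp, ← lampElt_one]
  exact hHc z

end LamplighterHarmonic

/-! ### Short relations of the lamplighter group -/

section ShortRelations

variable {G : Type*} [Group G]

/-- The homomorphism `ℤˣ →* G` with value `A` at `-1`, for an involution `A`. -/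
def unitsHom (A : G) (hA : A * A = 1) : ℤˣ →* G where
  toFun u := if u = 1 then 1 else A
  map_one' := by simp
  map_mul' u v := by
    rcases Int.units_eq_one_or u with rfl | rfl <;> rcases Int.units_eq_one_or v with rfl | rfl <;>
      simp [hA]

theorem unitsHom_neg_one (A : G) (hA : A * A = 1) : unitsHom A hA (-1) = A := by
  simp [unitsHom]

/-- If the conjugates `t ^ x * a * t ^ (-x)` with `|x| ≤ n` are commuting involutions, every
relation of length at most `n` of the lamplighter group holds for `a` and `t`. -/
theorem evalWord_eq_one_of_lamplighter {a t : G} (ha : a * a = 1) {n : ℕ}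
    (hcomm : ∀ d : ℤ, d.natAbs ≤ 2 * n → Commute a (t ^ d * a * t ^ (-d)))
    {w : List (Fin 4)} (hw : w.length ≤ n) (h1 : evalWord lampSwitch lampShift w = 1) :
    evalWord a t w = 1 := by
  let ι := {x : ℤ // x ∈ Finset.Icc (-(n : ℤ)) n}
  let A : ℤ → G := fun x => t ^ x * a * t ^ (-x)
  have hA : ∀ x, A x * A x = 1 := by
    intro x
    have : A x * A x = t ^ x * (a * a) * t ^ (-x) := by simp only [A]; group
    rw [this, ha]
    group
  have hAcomm : ∀ x y : ℤ, (y - x).natAbs ≤ 2 * n → Commute (A x) (A y) := by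
    intro x y hxy
    have h := hcomm (y - x) hxy
    have e1 : A x = t ^ x * a * (t ^ x)⁻¹ := by simp only [A]; group
    have e2 : A y = t ^ x * (t ^ (y - x) * a * t ^ (-(y - x))) * (t ^ x)⁻¹ := by
      simp only [A]; group
    rw [e1, e2]
    exact (Commute.conj_iff _).2 h
  let Φ : (x : ι) → ℤˣ →* G := fun x => unitsHom (A x) (hA x)
  have hΦ : Pairwise fun x y : ι => ∀ u v, Commute (Φ x u) (Φ y v) := by
    intro x y _ u v
    have hx := Finset.mem_Icc.1 x.2
    have hy := Finset.mem_Icc.1 y.2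
    have h := hAcomm x.1 y.1 (by omega)
    rcases Int.units_eq_one_or u with rfl | rfl
    · simp
    · rcases Int.units_eq_one_or v with rfl | rfl
      · simp
      · simpa only [Φ, unitsHom_neg_one] using h
  let Θ : (ι → ℤˣ) →* G := MonoidHom.noncommPiCoprod Φ hΦ
  have hΘ : ∀ x : ι, Θ (Pi.mulSingle x (-1)) = A x := by
    intro x
    rw [MonoidHom.noncommPiCoprod_mulSingle]
    exact unitsHom_neg_one _ _
  have key : ∀ w : List (Fin 4), w.length ≤ n → ∃ φ hφ z,
      evalWord lampSwitch lampShift w = lampElt φ hφ z ∧ z.natAbs ≤ w.length ∧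
      evalWord a t w = Θ (fun x => φ x) * t ^ z := by
    intro w
    induction w using List.reverseRecOn with
    | nil =>
      exact fun _ => ⟨1, by simp, 0, rfl, by simp,
        by rw [zpow_zero, mul_one]; exact (map_one Θ).symm⟩
    | append_singleton w i ih =>
      intro hw
      rw [List.length_append, List.length_singleton] at hw
      obtain ⟨φ, hφ, z, h1, h2, h3⟩ := ih (by omega)
      simp only [evalWord_append, evalWord_cons, evalWord_nil, mul_one, h1, h3,
        List.length_append, List.length_singleton]
      fin_cases i
      · exact ⟨φ, hφ, z, by simp [lazyGen], by omega, by simp [lazyGen]⟩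
      · refine ⟨_, finite_mulSupport_mul_mulSingle hφ z, z, lampElt_mul_switch φ hφ z, by omega, ?_⟩
        have hz : z ∈ Finset.Icc (-(n : ℤ)) n := Finset.mem_Icc.2 (by omega)
        have e : (fun x : ι => (φ * Pi.mulSingle z (-1) : ℤ → ℤˣ) x) =
            (fun x : ι => φ x) * Pi.mulSingle ⟨z, hz⟩ (-1) := by
          funext x
          simp only [Pi.mul_apply, Pi.mulSingle_apply]
          exact congrArg _ (if_congr (Subtype.ext_iff (a1 := x) (a2 := ⟨z, hz⟩)).symm rfl rfl)
        rw [e, map_mul, hΘ]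
        simp only [lazyGen, A]
        simp [mul_assoc]
      · refine ⟨φ, hφ, z + 1, lampElt_mul_shift φ hφ z, by omega, ?_⟩
        simp [lazyGen, zpow_add_one, mul_assoc]
      · refine ⟨φ, hφ, z - 1, lampElt_mul_shift_inv φ hφ z, by omega, ?_⟩
        simp [lazyGen, zpow_sub_one, mul_assoc]
  obtain ⟨φ, hφ, z, e1, -, e2⟩ := key w hw
  rw [h1, ← lampElt_one] at e1
  obtain ⟨rfl, rfl⟩ := lampElt_inj e1
  rw [e2, zpow_zero, mul_one]
  exact map_one Θ

end ShortRelations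

/-! ### The tree of cycles -/

section TreeOfCycles

/-- The vertices of a finite binary tree of cycles of length `3 K`: a node of the binary tree of
depth `N`, given by the path to the root, and a position on the cycle at this node. -/
abbrev CycleTree (N K : ℕ) : Type := {w : List Bool // w.length ≤ N} × ZMod (3 * K)

instance (N K : ℕ) [NeZero K] : Finite (CycleTree N K) := by
  have : Finite {w : List Bool // w.length ≤ N} := (List.finite_length_le Bool N).to_subtype
  have : NeZero (3 * K) := ⟨mul_ne_zero three_ne_zero (NeZero.ne K)⟩
  infer_instance

variable {N K : ℕ}

/-- The position `K` or `2 K` on a cycle where the child cycle of the given label is attached. -/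
def childMark (K : ℕ) (b : Bool) : ZMod (3 * K) := if b then (2 * K : ℕ) else (K : ℕ)

/-- The edges between cycles: position `0` of every cycle but the root one is matched with the mark
on its parent, and all other positions are fixed. -/
def cycleSwapFun (v : CycleTree N K) : CycleTree N K :=
  if v.2 = 0 then
    match v.1 with
    | ⟨[], _⟩ => v
    | ⟨b :: w, h⟩ => (⟨w, (Nat.le_succ _).trans h⟩, childMark K b)
  else if h : v.1.1.length < N then
    if v.2 = childMark K false then (⟨false :: v.1.1, h⟩, 0)
    else if v.2 = childMark K true then (⟨true :: v.1.1, h⟩, 0)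
    else v
  else v

theorem natCast_ne_natCast {i j : ℕ} (hi : i < 3 * K) (hj : j < 3 * K) (h : i ≠ j) :
    (i : ZMod (3 * K)) ≠ j := by
  intro h'
  have := congrArg ZMod.val h'
  rw [ZMod.val_natCast_of_lt hi, ZMod.val_natCast_of_lt hj] at this
  exact h this

theorem childMark_ne_zero (hK : 0 < K) (b : Bool) : childMark K b ≠ 0 := by
  have := natCast_ne_natCast (K := K) (i := if b then 2 * K else K) (j := 0)
    (by split_ifs <;> omega) (by omega) (by split_ifs <;> omega)
  cases b <;> simpa [childMark] using this

theorem childMark_ne (hK : 0 < K) : childMark K true ≠ childMark K false :=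
  natCast_ne_natCast (by omega) (by omega) (by omega)

theorem cycleSwapFun_root (h : ([] : List Bool).length ≤ N) :
    cycleSwapFun (⟨[], h⟩, (0 : ZMod (3 * K))) = (⟨[], h⟩, 0) := by
  simp [cycleSwapFun]

theorem cycleSwapFun_up (b : Bool) (w : List Bool) (h : (b :: w).length ≤ N) :
    cycleSwapFun (⟨b :: w, h⟩, (0 : ZMod (3 * K))) =
      (⟨w, (Nat.le_succ _).trans h⟩, childMark K b) := by
  simp [cycleSwapFun]

theorem cycleSwapFun_down (hK : 0 < K) (b : Bool) (w : List Bool) (h : (b :: w).length ≤ N) :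
    cycleSwapFun (⟨w, (Nat.le_succ _).trans h⟩, childMark K b) = (⟨b :: w, h⟩, 0) := by
  have h' : w.length < N := h
  cases b <;> simp [cycleSwapFun, childMark_ne_zero hK, childMark_ne hK, h']

theorem cycleSwapFun_leaf {v : CycleTree N K} (h0 : v.2 ≠ 0) (h : ¬ v.1.1.length < N) :
    cycleSwapFun v = v := by
  simp [cycleSwapFun, h0, h]

theorem cycleSwapFun_of_ne {v : CycleTree N K} (h0 : v.2 ≠ 0) (h : ∀ b, v.2 ≠ childMark K b) :
    cycleSwapFun v = v := by
  simp [cycleSwapFun, h0, h]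

/-- Case analysis on the vertices along the definition of `cycleSwapFun`. -/
theorem cycleTree_cases {P : CycleTree N K → Prop}
    (root : ∀ h, P (⟨[], h⟩, 0))
    (up : ∀ b w h, P (⟨b :: w, h⟩, 0))
    (down : ∀ b w (h : (b :: w).length ≤ N), P (⟨w, (Nat.le_succ _).trans h⟩, childMark K b))
    (leaf : ∀ v : CycleTree N K, v.2 ≠ 0 → ¬ v.1.1.length < N → P v)
    (other : ∀ v : CycleTree N K, v.2 ≠ 0 → (∀ b, v.2 ≠ childMark K b) → P v)
    (v : CycleTree N K) : P v := by
  by_cases h0 : v.2 = 0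
  · obtain ⟨⟨w, h⟩, i⟩ := v
    obtain rfl : i = 0 := h0
    cases w with
    | nil => exact root h
    | cons b w => exact up b w h
  · by_cases hl : v.1.1.length < N
    · by_cases hb : ∃ b, v.2 = childMark K b
      · obtain ⟨b, hb⟩ := hb
        obtain ⟨⟨w, h⟩, i⟩ := v
        obtain rfl : i = childMark K b := hb
        exact down b w hl
      · exact other v h0 fun b hb' => hb ⟨b, hb'⟩
    · exact leaf v h0 hl

theorem cycleSwapFun_involutive (hK : 0 < K) :
    Function.Involutive (cycleSwapFun : CycleTree N K → CycleTree N K) := by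
  intro v
  induction v using cycleTree_cases with
  | root h => rw [cycleSwapFun_root, cycleSwapFun_root]
  | up b w h => rw [cycleSwapFun_up, cycleSwapFun_down hK]
  | down b w h => rw [cycleSwapFun_down hK b w h, cycleSwapFun_up]
  | leaf v h0 h => rw [cycleSwapFun_leaf h0 h, cycleSwapFun_leaf h0 h]
  | other v h0 h => rw [cycleSwapFun_of_ne h0 h, cycleSwapFun_of_ne h0 h]

variable (N K) in
/-- The involution that jumps between adjacent cycles. -/
def cycleSwap [NeZero K] : Equiv.Perm (CycleTree N K) :=
  (cycleSwapFun_involutive (NeZero.pos K)).toPerm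

variable (N K) in
/-- The rotation of every cycle by one step. -/
def cycleShift : Equiv.Perm (CycleTree N K) :=
  (Equiv.refl _).prodCongr (Equiv.addRight 1)

theorem cycleShift_apply (v : CycleTree N K) : cycleShift N K v = (v.1, v.2 + 1) := rfl

theorem cycleShift_inv_apply (v : CycleTree N K) : (cycleShift N K)⁻¹ v = (v.1, v.2 - 1) := by
  rw [Equiv.Perm.inv_eq_iff_eq, cycleShift_apply]
  simp

theorem cycleShift_zpow_apply (d : ℤ) (v : CycleTree N K) :
    (cycleShift N K ^ d) v = (v.1, v.2 + d) := by
  induction d generalizing v with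
  | zero => simp
  | succ d ih =>
    rw [zpow_add_one, Equiv.Perm.mul_apply, ih, cycleShift_apply]
    push_cast
    rw [add_right_comm, add_assoc]
  | pred d ih =>
    rw [zpow_sub_one, Equiv.Perm.mul_apply, ih, cycleShift_inv_apply]
    push_cast
    rw [sub_add_eq_add_sub, add_sub_assoc]

variable [NeZero K]

theorem cycleSwap_apply (v : CycleTree N K) : cycleSwap N K v = cycleSwapFun v := rfl

theorem cycleSwap_mul_self : cycleSwap N K * cycleSwap N K = 1 :=
  Equiv.ext fun v => cycleSwapFun_involutive (NeZero.pos K) v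

/-- The jumps take place at positions divisible by `K` only. -/
theorem castHom_eq_zero_of_cycleSwap_ne {v : CycleTree N K} (h : cycleSwap N K v ≠ v) :
    ZMod.castHom (dvd_mul_left K 3) (ZMod K) v.2 = 0 := by
  rw [cycleSwap_apply] at h
  induction v using cycleTree_cases with
  | root => simp
  | up => simp
  | down b => cases b <;> simp [childMark]
  | leaf v h0 hl => exact absurd (cycleSwapFun_leaf h0 hl) h
  | other v h0 hb => exact absurd (cycleSwapFun_of_ne h0 hb) h

theorem commute_cycleSwap_conj {d : ℤ} (hd : d.natAbs < K) :
    Commute (cycleSwap N K) (cycleShift N K ^ d * cycleSwap N K * cycleShift N K ^ (-d)) := by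
  rcases eq_or_ne d 0 with rfl | hd0
  · simp
  refine Equiv.Perm.Disjoint.commute fun v => ?_
  by_contra! hv
  have h1 := castHom_eq_zero_of_cycleSwap_ne hv.1
  have h2 : cycleSwap N K ((cycleShift N K ^ (-d)) v) ≠ (cycleShift N K ^ (-d)) v := by
    intro h
    apply hv.2
    rw [Equiv.Perm.mul_apply, Equiv.Perm.mul_apply, h, ← Equiv.Perm.mul_apply, ← zpow_add,
      add_neg_cancel, zpow_zero, Equiv.Perm.one_apply]
  have h3 := castHom_eq_zero_of_cycleSwap_ne h2
  rw [cycleShift_zpow_apply, map_add, h1, zero_add, map_intCast, ZMod.intCast_zmod_eq_zero_iff_dvd,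
    Int.natCast_dvd, Int.natAbs_neg] at h3
  have := Nat.le_of_dvd (by omega) h3
  omega

end TreeOfCycles

/-! ### Drift of the walk on the tree of cycles -/

section Drift

/-- The height along a cycle: slope `± 4 K` on the two arcs next to position `0`, constant on the
third arc, plus the convex correction `- i * (K - i)` on each arc. -/
def arcHeight (K j : ℤ) : ℤ :=
  if j ≤ K then 4 * K * j - j * (K - j)
  else if j ≤ 2 * K then 4 * K * K - (j - K) * (2 * K - j)
  else 4 * K * (3 * K - j) - (j - 2 * K) * (3 * K - j)

theorem arcHeight_of_le {K j : ℤ} (h : j ≤ K) : arcHeight K j = 4 * K * j - j * (K - j) :=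
  if_pos h

theorem arcHeight_of_le_of_le {K j : ℤ} (h : K ≤ j) (h' : j ≤ 2 * K) :
    arcHeight K j = 4 * K * K - (j - K) * (2 * K - j) := by
  rcases h.eq_or_lt with rfl | h
  · rw [arcHeight_of_le le_rfl]; ring
  · rw [arcHeight, if_neg (not_le.2 h), if_pos h']

theorem arcHeight_of_ge {K j : ℤ} (hK : 0 < K) (h : 2 * K ≤ j) :
    arcHeight K j = 4 * K * (3 * K - j) - (j - 2 * K) * (3 * K - j) := by
  rcases h.eq_or_lt with rfl | h
  · rw [arcHeight_of_le_of_le (by omega) le_rfl]; ring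
  · rw [arcHeight, if_neg (by omega), if_neg (by omega)]

variable {N K : ℕ}

/-- A potential on the tree of cycles with uniformly positive drift. The increment
`4 * K ^ 2 + 6 * K` per level is chosen so that the jumps to a child and to the parent balance the
slopes of the height on the cycle, leaving total drift at least `2` at every vertex above the
leaves of the tree. -/
def cyclePotential (v : CycleTree N K) : ℤ :=
  (4 * K ^ 2 + 6 * K) * v.1.1.length + arcHeight K v.2.val

theorem cyclePotential_natCast [NeZero K] (w : {w : List Bool // w.length ≤ N}) {j : ℕ}
    (hj : j ≤ 3 * K) : cyclePotential (w, (j : ZMod (3 * K))) =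
      (4 * K ^ 2 + 6 * K) * w.1.length + arcHeight K j := by
  have hK : (0 : ℤ) < K := by exact_mod_cast NeZero.pos K
  rcases hj.eq_or_lt with rfl | hj
  · rw [ZMod.natCast_self]
    simp only [cyclePotential, ZMod.val_zero]
    rw [arcHeight_of_le (by simp), arcHeight_of_ge hK (by push_cast; omega)]
    push_cast
    ring
  · simp only [cyclePotential, ZMod.val_natCast_of_lt hj]

theorem cyclePotential_zero (w : {w : List Bool // w.length ≤ N}) :
    cyclePotential (w, (0 : ZMod (3 * K))) = (4 * K ^ 2 + 6 * K) * w.1.length := by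
  simp [cyclePotential, arcHeight]

theorem cyclePotential_childMark [NeZero K] (w : {w : List Bool // w.length ≤ N}) (b : Bool) :
    cyclePotential (w, childMark K b) = (4 * K ^ 2 + 6 * K) * w.1.length + 4 * K ^ 2 := by
  cases b
  · rw [childMark, if_neg (by simp), cyclePotential_natCast w (by omega),
      arcHeight_of_le le_rfl]
    ring
  · rw [childMark, if_pos rfl, cyclePotential_natCast w (by omega),
      arcHeight_of_le_of_le (by push_cast; omega) (by push_cast; omega)]
    push_cast
    ring

theorem arcHeight_succ_sub_abs_le {K j : ℤ} (hK : 0 < K) (h0 : 0 ≤ j) (h1 : j < 3 * K) :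
    |arcHeight K (j + 1) - arcHeight K j| ≤ 6 * K := by
  rw [abs_le]
  rcases lt_or_ge j K with h | h
  · rw [arcHeight_of_le h.le, arcHeight_of_le (by omega)]
    constructor <;> nlinarith
  · rcases lt_or_ge j (2 * K) with h' | h'
    · rw [arcHeight_of_le_of_le h h'.le, arcHeight_of_le_of_le (by omega) (by omega)]
      constructor <;> nlinarith
    · rw [arcHeight_of_ge hK h', arcHeight_of_ge hK (by omega)]
      constructor <;> nlinarith

theorem arcHeight_interior {K j : ℤ} (hK : 0 < K) (h0 : j ≠ K) (h1 : j ≠ 2 * K) :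
    arcHeight K (j + 1) + arcHeight K (j - 1) = 2 * arcHeight K j + 2 := by
  rcases lt_or_gt_of_ne h0 with h | h
  · rw [arcHeight_of_le h.le, arcHeight_of_le (by omega), arcHeight_of_le (by omega)]
    ring
  · rcases lt_or_gt_of_ne h1 with h' | h'
    · rw [arcHeight_of_le_of_le h.le h'.le, arcHeight_of_le_of_le (by omega) (by omega),
        arcHeight_of_le_of_le (by omega) (by omega)]
      ring
    · rw [arcHeight_of_ge hK h'.le, arcHeight_of_ge hK (by omega), arcHeight_of_ge hK (by omega)]
      ring

variable (N K) in
/-- The potential at the image of the root under `σ⁻¹`. Right multiplication of `σ` by a step moves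
this image along an edge of the tree of cycles. -/
def rootPotential (σ : Equiv.Perm (CycleTree N K)) : ℝ :=
  cyclePotential (σ⁻¹ ((⟨[], Nat.zero_le N⟩, 0) : CycleTree N K))

theorem rootPotential_one : rootPotential N K 1 = 0 := by
  simp [rootPotential, cyclePotential_zero]

variable [NeZero K]

theorem exists_natCast_eq (i : ZMod (3 * K)) : ∃ j : ℕ, j < 3 * K ∧ i = j := by
  have : NeZero (3 * K) := ⟨mul_ne_zero three_ne_zero (NeZero.ne K)⟩
  exact ⟨i.val, i.val_lt, (ZMod.natCast_zmod_val i).symm⟩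

theorem abs_cyclePotential_shift_sub_le (v : CycleTree N K) :
    |cyclePotential (cycleShift N K v) - cyclePotential v| ≤ 6 * K := by
  obtain ⟨w, i⟩ := v
  obtain ⟨j, hj, rfl⟩ := exists_natCast_eq i
  have hK : (0 : ℤ) < K := by exact_mod_cast NeZero.pos K
  rw [cycleShift_apply, ← Nat.cast_succ, cyclePotential_natCast w hj.le,
    cyclePotential_natCast w hj, add_sub_add_left_eq_sub]
  push_cast
  exact arcHeight_succ_sub_abs_le hK (by omega) (by omega)

theorem abs_cyclePotential_swap_sub_le (v : CycleTree N K) :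
    |cyclePotential (cycleSwap N K v) - cyclePotential v| ≤ 6 * K := by
  have hK : 0 < K := NeZero.pos K
  rw [cycleSwap_apply]
  induction v using cycleTree_cases with
  | root h => rw [cycleSwapFun_root]; simp
  | up b w h =>
    rw [cycleSwapFun_up, cyclePotential_childMark, cyclePotential_zero, abs_le, List.length_cons]
    push_cast
    constructor <;> linarith
  | down b w h =>
    rw [cycleSwapFun_down hK b w h, cyclePotential_childMark, cyclePotential_zero, abs_le,
      List.length_cons]
    push_cast
    constructor <;> linarith
  | leaf v h0 h => rw [cycleSwapFun_leaf h0 h]; simp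
  | other v h0 h => rw [cycleSwapFun_of_ne h0 h]; simp

theorem cyclePotential_drift (v : CycleTree N K) (hv : v.1.1.length < N) :
    3 * cyclePotential v + 2 ≤ cyclePotential (cycleSwap N K v) +
      cyclePotential (cycleShift N K v) + cyclePotential ((cycleShift N K)⁻¹ v) := by
  have hK : 0 < K := NeZero.pos K
  have hK' : (0 : ℤ) < K := by exact_mod_cast hK
  have hshift0 : ∀ w : {w : List Bool // w.length ≤ N},
      cyclePotential (cycleShift N K (w, 0)) + cyclePotential ((cycleShift N K)⁻¹ (w, 0)) =
        2 * cyclePotential (w, (0 : ZMod (3 * K))) + 6 * K + 2 := by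
    intro w
    have e1 : ((0 : ZMod (3 * K)) + 1) = (1 : ℕ) := by simp
    have e2 : ((0 : ZMod (3 * K)) - 1) = (3 * K - 1 : ℕ) := by
      rw [Nat.cast_sub (by omega), ZMod.natCast_self, Nat.cast_one]
    rw [cycleShift_apply, cycleShift_inv_apply, e1, e2, cyclePotential_natCast w (by omega),
      cyclePotential_natCast w (by omega), cyclePotential_zero,
      arcHeight_of_le (by exact_mod_cast hK),
      arcHeight_of_ge hK' (by omega)]
    push_cast [Nat.cast_sub (show 1 ≤ 3 * K by omega)]
    ring
  have hshift1 : ∀ (w : {w : List Bool // w.length ≤ N}) (b : Bool),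
      cyclePotential (cycleShift N K (w, childMark K b)) +
        cyclePotential ((cycleShift N K)⁻¹ (w, childMark K b)) + 6 * K =
        2 * cyclePotential (w, childMark K b) + 2 := by
    intro w b
    set c : ℕ := if b then 2 * K else K with hc
    have hcK : K ≤ c ∧ c ≤ 2 * K := by rw [hc]; split_ifs <;> omega
    have e0 : childMark K b = (c : ℕ) := by cases b <;> simp [childMark, hc]
    have e1 : childMark K b + 1 = (c + 1 : ℕ) := by rw [e0]; simp
    have e2 : childMark K b - 1 = (c - 1 : ℕ) := by
      rw [e0, Nat.cast_sub (by omega), Nat.cast_one]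
    rw [cycleShift_apply, cycleShift_inv_apply, cyclePotential_childMark, e1, e2,
      cyclePotential_natCast w (by omega), cyclePotential_natCast w (by omega)]
    push_cast [Nat.cast_sub (show 1 ≤ c by omega)]
    cases b
    · have : (c : ℤ) = K := by simp [hc]
      rw [this, arcHeight_of_le_of_le (by omega) (by omega), arcHeight_of_le (by omega)]
      ring
    · have : (c : ℤ) = 2 * K := by simp [hc]
      rw [this, arcHeight_of_ge hK' (by omega), arcHeight_of_le_of_le (by omega) (by omega)]
      ring
  rw [cycleSwap_apply]
  induction v using cycleTree_cases with
  | root h =>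
    have := hshift0 ⟨[], h⟩
    rw [cycleSwapFun_root]
    linarith
  | up b w h =>
    have := hshift0 ⟨b :: w, h⟩
    rw [cyclePotential_zero, List.length_cons] at this
    rw [cycleSwapFun_up, cyclePotential_childMark, cyclePotential_zero, List.length_cons]
    push_cast at *
    linarith
  | down b w h =>
    have := hshift1 ⟨w, (Nat.le_succ _).trans h⟩ b
    rw [cyclePotential_childMark] at this
    rw [cycleSwapFun_down hK b w h, cyclePotential_childMark, cyclePotential_zero,
      List.length_cons]
    push_cast at *
    linarith
  | leaf v h0 h => exact absurd hv h
  | other v h0 h =>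
    rw [cycleSwapFun_of_ne h0 h]
    obtain ⟨w, i⟩ := v
    obtain ⟨j, hj, rfl⟩ := exists_natCast_eq i
    have hj0 : j ≠ 0 := by rintro rfl; simp at h0
    have hj1 : j ≠ K := by rintro rfl; exact h false rfl
    have hj2 : j ≠ 2 * K := by rintro rfl; exact h true rfl
    have e1 : (j : ZMod (3 * K)) + 1 = (j + 1 : ℕ) := by simp
    have e2 : (j : ZMod (3 * K)) - 1 = (j - 1 : ℕ) := by
      rw [Nat.cast_sub (by omega), Nat.cast_one]
    rw [cycleShift_apply, cycleShift_inv_apply, e1, e2, cyclePotential_natCast w hj.le,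
      cyclePotential_natCast w (by omega), cyclePotential_natCast w (by omega)]
    have := arcHeight_interior hK' (j := j) (by omega) (by omega)
    push_cast [Nat.cast_sub (show 1 ≤ j by omega)]
    linarith

theorem length_cycleSwap_le (v : CycleTree N K) :
    (cycleSwap N K v).1.1.length ≤ v.1.1.length + 1 := by
  rw [cycleSwap_apply]
  induction v using cycleTree_cases with
  | root h => rw [cycleSwapFun_root]; simp
  | up b w h => rw [cycleSwapFun_up]; simp; omega
  | down b w h => rw [cycleSwapFun_down (NeZero.pos K) b w h]; simp
  | leaf v h0 h => rw [cycleSwapFun_leaf h0 h]; simp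
  | other v h0 h => rw [cycleSwapFun_of_ne h0 h]; simp

theorem cycleSwap_inv : (cycleSwap N K)⁻¹ = cycleSwap N K :=
  inv_eq_of_mul_eq_one_left cycleSwap_mul_self

theorem length_evalWord_inv_le (w : List (Fin 4)) (v : CycleTree N K) :
    ((evalWord (cycleSwap N K) (cycleShift N K) w)⁻¹ v).1.1.length ≤ v.1.1.length + w.length := by
  induction w generalizing v with
  | nil => simp
  | cons i w ih =>
    rw [evalWord_cons, mul_inv_rev, Equiv.Perm.mul_apply, List.length_cons]
    have h : ((lazyGen (cycleSwap N K) (cycleShift N K) i)⁻¹ v).1.1.length ≤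
        v.1.1.length + 1 := by
      fin_cases i
      · simp [lazyGen]
      · simpa [lazyGen, cycleSwap_inv] using length_cycleSwap_le v
      · simp [lazyGen, cycleShift_inv_apply]
      · simp [lazyGen, cycleShift_apply]
    have := ih ((lazyGen (cycleSwap N K) (cycleShift N K) i)⁻¹ v)
    omega

theorem abs_rootPotential_mul_sub_le (σ : Equiv.Perm (CycleTree N K)) (i : Fin 4) :
    |rootPotential N K (σ * lazyGen (cycleSwap N K) (cycleShift N K) i) - rootPotential N K σ| ≤
      6 * K := by
  rw [rootPotential, rootPotential, mul_inv_rev, Equiv.Perm.mul_apply]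
  set v := σ⁻¹ ((⟨[], Nat.zero_le N⟩, 0) : CycleTree N K)
  have h : |cyclePotential ((lazyGen (cycleSwap N K) (cycleShift N K) i)⁻¹ v) -
      cyclePotential v| ≤ 6 * K := by
    fin_cases i
    · simp [lazyGen]
    · simpa [lazyGen, cycleSwap_inv] using abs_cyclePotential_swap_sub_le v
    · have := abs_cyclePotential_shift_sub_le ((cycleShift N K)⁻¹ v)
      rw [← Equiv.Perm.mul_apply, mul_inv_cancel, Equiv.Perm.one_apply, abs_sub_comm] at this
      simpa [lazyGen] using this
    · simpa [lazyGen] using abs_cyclePotential_shift_sub_le v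
  exact_mod_cast h

theorem rootPotential_drift {w : List (Fin 4)} (hw : w.length < N) :
    rootPotential N K (evalWord (cycleSwap N K) (cycleShift N K) w) + 1 / 2 ≤
      lazyOp (cycleSwap N K) (cycleShift N K) (rootPotential N K)
        (evalWord (cycleSwap N K) (cycleShift N K) w) := by
  have h1 := length_evalWord_inv_le w ((⟨[], Nat.zero_le N⟩, 0) : CycleTree N K)
  simp only [List.length_nil, zero_add] at h1
  have h2 := cyclePotential_drift _ (h1.trans_lt hw)
  have h3 := (Int.cast_le (R := ℝ)).2 h2
  rw [lazyOp, Fin.sum_univ_four]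
  simp only [lazyGen, Matrix.cons_val, rootPotential, mul_one, mul_inv_rev, inv_inv,
    Equiv.Perm.mul_apply, cycleSwap_inv]
  push_cast at h3
  linarith

end Drift

/-! ### The diagonal product -/

section DiagonalProduct

variable (N : ℕ → ℕ)

/-- The product of the lamplighter group with the permutation groups of the trees of cycles of depth
`N s` and cycle length `3 (s + 2)`. -/
abbrev AmbientProduct : Type :=
  lamplighter ℤˣ × ((s : ℕ) → Equiv.Perm (CycleTree (N s) (s + 2)))

/-- The diagonal product of the groups generated by two marked elements in each factor. -/
def diagonalProduct : Subgroup (AmbientProduct N) :=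
  Subgroup.closure {(lampSwitch, fun s => cycleSwap (N s) (s + 2)),
    (lampShift, fun s => cycleShift (N s) (s + 2))}

/-- The diagonal involution. -/
def diagSwitch : diagonalProduct N :=
  ⟨(lampSwitch, fun s => cycleSwap (N s) (s + 2)), Subgroup.subset_closure (by simp)⟩

/-- The diagonal translation. -/
def diagShift : diagonalProduct N :=
  ⟨(lampShift, fun s => cycleShift (N s) (s + 2)), Subgroup.subset_closure (by simp)⟩

/-- The projection to the lamplighter group. -/
def diagLamp : diagonalProduct N →* lamplighter ℤˣ :=
  (MonoidHom.fst _ _).comp (diagonalProduct N).subtype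

/-- The projection to the permutation group of a tree of cycles. -/
def diagCoord (s : ℕ) : diagonalProduct N →* Equiv.Perm (CycleTree (N s) (s + 2)) :=
  ((Pi.evalMonoidHom _ s).comp (MonoidHom.snd _ _)).comp (diagonalProduct N).subtype

theorem diagSwitch_mul_self : diagSwitch N * diagSwitch N = 1 :=
  Subtype.ext (Prod.ext lampSwitch_mul_self (funext fun _ => cycleSwap_mul_self))

theorem closure_diag_eq_top : Subgroup.closure {diagSwitch N, diagShift N} = ⊤ := by
  refine (congrArg Subgroup.closure ?_).trans Subgroup.closure_closure_coe_preimage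
  ext x
  simp only [Set.mem_insert_iff, Set.mem_singleton_iff, Subtype.ext_iff]
  rfl

theorem diagLamp_evalWord (w : List (Fin 4)) :
    diagLamp N (evalWord (diagSwitch N) (diagShift N) w) = evalWord lampSwitch lampShift w :=
  map_evalWord _ _ _ _

theorem diagLamp_surjective : Function.Surjective (diagLamp N) := fun q => by
  obtain ⟨w, rfl⟩ := exists_evalWord_lamplighter q
  exact ⟨_, diagLamp_evalWord N w⟩

/-- The elements that are trivial in the lamplighter group and in all but the first `n` trees. -/
def diagKernel (n : ℕ) : Subgroup (diagonalProduct N) :=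
  ((diagLamp N).prod (MonoidHom.pi fun s : {s : ℕ // n ≤ s} => diagCoord N s)).ker

theorem mem_diagKernel {n : ℕ} {g : diagonalProduct N} :
    g ∈ diagKernel N n ↔ diagLamp N g = 1 ∧ ∀ s, n ≤ s → diagCoord N s g = 1 := by
  simp only [diagKernel, MonoidHom.mem_ker, MonoidHom.prod_apply, Prod.mk_eq_one, funext_iff,
    Subtype.forall]
  rfl

instance (n : ℕ) : (diagKernel N n).Normal := by
  unfold diagKernel
  infer_instance

instance (n : ℕ) : Finite (diagKernel N n) := by
  refine Finite.of_injective (β := (s : Fin n) → Equiv.Perm (CycleTree (N s) (s + 2)))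
    (fun g s => diagCoord N s g.1) fun g g' h => ?_
  obtain ⟨h1, h2⟩ := (mem_diagKernel N).1 g.2
  obtain ⟨h1', h2'⟩ := (mem_diagKernel N).1 g'.2
  refine Subtype.ext (Subtype.ext (Prod.ext (h1.trans h1'.symm) (funext fun s => ?_)))
  rcases lt_or_ge s n with hs | hs
  · exact congrFun h ⟨s, hs⟩
  · exact (h2 s hs).trans (h2' s hs).symm

theorem exists_mem_diagKernel {g : diagonalProduct N} (hg : diagLamp N g = 1) :
    ∃ n, g ∈ diagKernel N n := by
  obtain ⟨w, rfl⟩ := exists_evalWord_eq (diagSwitch_mul_self N) (closure_diag_eq_top N) g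
  refine ⟨2 * w.length, (mem_diagKernel N).2 ⟨hg, fun s hs => ?_⟩⟩
  rw [diagLamp_evalWord] at hg
  rw [map_evalWord]
  exact evalWord_eq_one_of_lamplighter (n := w.length) cycleSwap_mul_self
    (fun d hd => commute_cycleSwap_conj (by omega)) le_rfl hg

/-- The lazy walk on the diagonal product. -/
noncomputable abbrev diagMeasure : PMF (diagonalProduct N) :=
  lazyMeasure (diagSwitch N) (diagShift N)

/-- Harmonic functions of sub-exponential growth factor through the lamplighter group, because the
kernel of the projection is a union of finite normal subgroups. -/
theorem exists_eq_comp_diagLamp {S : Set (diagonalProduct N)} (hS : IsFiniteGenerating S)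
    {h : diagonalProduct N → ℝ} (hh : IsHarmonic (diagMeasure N) h)
    (hgrowth : HasSubexponentialGrowth S h) : ∃ k : lamplighter ℤˣ → ℝ, h = k ∘ diagLamp N := by
  refine ⟨fun q => h (Function.surjInv (diagLamp_surjective N) q), funext fun g => ?_⟩
  set g' := Function.surjInv (diagLamp_surjective N) (diagLamp N g)
  have hg' : diagLamp N g' = diagLamp N g := Function.surjInv_eq _ _
  obtain ⟨n, hn⟩ := exists_mem_diagKernel N (g := g * g'⁻¹) (by rw [map_mul, map_inv, hg',
    mul_inv_cancel])
  have := hh.mul_left_eq_of_mem hS (diagSwitch_mul_self N) (closure_diag_eq_top N) hgrowth hn g'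
  rw [inv_mul_cancel_right] at this
  exact this

theorem sublinearHarmonicConstant_diag {S : Set (diagonalProduct N)}
    (hS : IsFiniteGenerating S) : SublinearHarmonicConstant S (diagMeasure N) := by
  intro h hh hgrowth
  obtain ⟨k, rfl⟩ := exists_eq_comp_diagLamp N hS hh hgrowth.hasSubexponentialGrowth
  obtain ⟨C, hC⟩ := exists_wordLength_evalWord_le hS (diagSwitch N) (diagShift N)
  have hk : IsHarmonic (lazyMeasure lampSwitch lampShift) k := by
    rw [isHarmonic_lazyMeasure_iff] at hh ⊢
    intro q
    obtain ⟨g, rfl⟩ := diagLamp_surjective N q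
    rw [← Function.comp_apply (f := k), ← hh g]
    simp only [lazyOp, Function.comp_apply, map_mul, map_lazyGen]
    rfl
  refine ⟨k 1, fun g => hk.eq_of_sublinear_lamplighter
    (m := fun n => maxOnBall S (k ∘ diagLamp N) ((C + 1) * n)) (fun n w hw => ?_) ?_ _⟩
  · rw [← diagLamp_evalWord N]
    refine abs_le_maxOnBall hS (k ∘ diagLamp N) ((hC w).trans ?_)
    exact Nat.mul_le_mul (Nat.le_succ C) hw
  · have h1 : Tendsto (fun n : ℕ => (C + 1) * n) atTop atTop :=
      tendsto_atTop_mono (fun n => by simp only [id]; nlinarith [Nat.zero_le (C * n)]) tendsto_id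
    have h2 := (hgrowth.comp h1).mul_const ((C : ℝ) + 1)
    rw [zero_mul] at h2
    refine h2.congr fun n => ?_
    have hC0 : (C : ℝ) + 1 ≠ 0 := by positivity
    simp only [Function.comp_apply]
    push_cast
    rcases eq_or_ne (n : ℝ) 0 with hn | hn
    · simp [hn]
    · field_simp

/-- Up to time `N s`, the walk has positive speed, of order `1 / (s + 2)`, already on the tree of
cycles of index `s`. -/
theorem exists_le_mul_speed_diag {S : Set (diagonalProduct N)} (hS : IsFiniteGenerating S) :
    ∃ C : ℕ, ∀ s n : ℕ, n ≤ N s → (n : ℝ) ≤ 12 * (s + 2) * (C * speed S (diagMeasure N) n) := by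
  obtain ⟨C, hC⟩ := exists_abs_sub_le_mul_wordLength hS (diagSwitch_mul_self N)
    (closure_diag_eq_top N)
  refine ⟨C, fun s n hn => ?_⟩
  set Ψ : diagonalProduct N → ℝ := fun g => rootPotential (N s) (s + 2) (diagCoord N s g) with hΨ
  have hmap : ∀ g i, diagCoord N s (g * lazyGen (diagSwitch N) (diagShift N) i) =
      diagCoord N s g * lazyGen (cycleSwap (N s) (s + 2)) (cycleShift (N s) (s + 2)) i := by
    intro g i
    rw [map_mul, map_lazyGen]
    rfl
  have hΨ1 : Ψ 1 = 0 := by simp only [hΨ, map_one, rootPotential_one]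
  have hlip := hC Ψ (6 * (s + 2)) fun g i => by
    have := abs_rootPotential_mul_sub_le (diagCoord N s g) i
    rw [← hmap] at this
    push_cast at this
    exact this
  have hdrift := add_mul_le_walkMean (a := diagSwitch N) (t := diagShift N) (φ := Ψ) (c := 1 / 2)
    (N := N s) (fun w hw => by
      have := rootPotential_drift (K := s + 2) hw
      have hw' : diagCoord N s (evalWord (diagSwitch N) (diagShift N) w) =
          evalWord (cycleSwap (N s) (s + 2)) (cycleShift (N s) (s + 2)) w := map_evalWord _ _ _ _
      rw [← hw'] at this
      simp only [lazyOp, ← hmap] at this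
      exact this) hn
  have hmono : walkMean (diagSwitch N) (diagShift N) n Ψ ≤
      walkMean (diagSwitch N) (diagShift N) n
        fun g => 6 * ((s : ℝ) + 2) * C * (wordLength S g : ℝ) := walkMean_mono fun w _ => by
    have := (le_abs_self _).trans (hlip (evalWord (diagSwitch N) (diagShift N) w))
    rw [hΨ1, sub_zero] at this
    linarith
  rw [walkMean_const_mul] at hmono
  have hspeed : walkMean (diagSwitch N) (diagShift N) n (fun g => (wordLength S g : ℝ)) =
      speed S (diagMeasure N) n := rfl
  rw [hspeed] at hmono
  rw [hΨ1] at hdrift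
  linarith

end DiagonalProduct

/-! ### Choice of the depths -/

section Depths

theorem le_mul_of_subadditive {f : ℝ≥0 → ℝ≥0} (hf : ∀ x y, f (x + y) ≤ f x + f y) {n : ℕ}
    (hn : 1 ≤ n) : f n ≤ n * f 1 := by
  induction n, hn using Nat.le_induction with
  | base => simp
  | succ n _ ih =>
    push_cast
    calc f (n + 1) ≤ f n + f 1 := hf _ _
      _ ≤ n * f 1 + f 1 := by gcongr
      _ = (n + 1) * f 1 := by ring

/-- Depths `N s` such that every time `n` lies below some `N s` with `f n` of order at most
`n / (s + 2)`. -/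
theorem exists_depths {f : ℝ≥0 → ℝ≥0} (hf : ∀ x y, f (x + y) ≤ f x + f y)
    (hlim : Tendsto (fun x => f x / x) atTop (𝓝 0)) :
    ∃ (N : ℕ → ℕ) (A : ℝ), 0 < A ∧ ∀ n : ℕ, 1 ≤ n →
      ∃ s, n ≤ N s ∧ (f n : ℝ) * (12 * (s + 2)) ≤ A * n := by
  have hT : ∀ s : ℕ, ∃ T : ℕ, ∀ n : ℕ, T < n → (f n : ℝ) * (12 * (s + 2)) ≤ n := by
    intro s
    have h1 : Tendsto (fun n : ℕ => f n / (n : ℝ≥0)) atTop (𝓝 0) :=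
      hlim.comp tendsto_natCast_atTop_atTop
    have h2 := h1.eventually (gt_mem_nhds (by positivity : (0 : ℝ≥0) < (12 * ((s : ℝ≥0) + 2))⁻¹))
    obtain ⟨T, hT⟩ := eventually_atTop.1 h2
    refine ⟨T, fun n hn => ?_⟩
    have h3 := (hT n hn.le).le
    have hn0 : (0 : ℝ≥0) < n := by exact_mod_cast (Nat.zero_le T).trans_lt hn
    rw [div_le_iff₀ hn0, inv_mul_eq_div, le_div_iff₀ (by positivity)] at h3
    exact_mod_cast h3
  choose T hT using hT
  refine ⟨fun s => s + T (s + 1), 24 * f 1 + 1, by positivity, fun n hn => ?_⟩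
  have hex : ∃ s, n ≤ s + T (s + 1) := ⟨n, Nat.le_add_right _ _⟩
  classical
  refine ⟨Nat.find hex, Nat.find_spec hex, ?_⟩
  -- if `s + 1` is the least index with `n ≤ N (s + 1)`, then `n > N s ≥ T (s + 1)`
  rcases h : Nat.find hex with _ | s
  · have h1 : (f n : ℝ) ≤ n * f 1 := by exact_mod_cast le_mul_of_subadditive hf hn
    have h2 : (0 : ℝ) ≤ n := Nat.cast_nonneg n
    push_cast
    linarith
  · have h1 := Nat.find_min hex (m := s) (by omega)
    have h2 := hT (s + 1) n (by omega)
    have h3 : (0 : ℝ) ≤ 24 * f 1 * n := by positivity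
    linarith

end Depths

/-! ### Speed at least `n ^ (3 / 4)` is not diffusive -/

section ThreeQuarters

theorem not_hasDiffusiveSpeed_of_rpow_le {G : Type*} [Group G] {S : Set G} {μ : PMF G} {c : ℝ}
    (hc : 0 < c) (h : ∀ n : ℕ, 1 ≤ n → c * (((n : ℝ≥0) ^ (3 / 4 : ℝ) : ℝ≥0) : ℝ) ≤ speed S μ n) :
    ¬ HasDiffusiveSpeed S μ := by
  rintro ⟨C, hC⟩
  -- at the time `(m + 1) ^ 4`, the two bounds are `c * (m + 1) ^ 3` and `C * (m + 1) ^ 2`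
  obtain ⟨m, hm⟩ := exists_nat_gt (C / c)
  rw [div_lt_iff₀ hc] at hm
  have hm1 : 1 ≤ (m + 1) ^ 4 := Nat.one_le_pow _ _ (Nat.succ_pos m)
  have h1 := (h _ hm1).trans (hC _ hm1)
  have h2 : ((((m + 1) ^ 4 : ℕ) : ℝ≥0) ^ (3 / 4 : ℝ) : ℝ≥0) = ((m : ℝ≥0) + 1) ^ 3 := by
    push_cast
    rw [← NNReal.rpow_natCast, ← NNReal.rpow_mul, ← NNReal.rpow_natCast]
    norm_num
  have h3 : Real.sqrt (((m + 1) ^ 4 : ℕ) : ℝ) = ((m : ℝ) + 1) ^ 2 := by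
    push_cast
    rw [show ((m : ℝ) + 1) ^ 4 = (((m : ℝ) + 1) ^ 2) ^ 2 by ring, Real.sqrt_sq (by positivity)]
  rw [h2, h3] at h1
  push_cast at h1
  have h4 : c * (m + 1) ≤ C := by
    refine le_of_mul_le_mul_right ?_ (by positivity : (0 : ℝ) < ((m : ℝ) + 1) ^ 2)
    linarith
  linarith

theorem tendsto_rpow_three_quarters_div :
    Tendsto (fun x : ℝ≥0 => x ^ (3 / 4 : ℝ) / x) atTop (𝓝 0) := by
  have h1 : Tendsto (fun x : ℝ≥0 => (x ^ (1 / 4 : ℝ))⁻¹) atTop (𝓝 0) :=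
    tendsto_inv_atTop_zero.comp (NNReal.tendsto_rpow_atTop (by norm_num))
  refine h1.congr' ?_
  filter_upwards [eventually_gt_atTop 0] with x hx
  rw [← NNReal.rpow_neg, ← NNReal.rpow_sub_one hx.ne']
  norm_num

end ThreeQuarters

/-! ### Groups with prescribed speed and few harmonic functions -/

theorem corollary1p3 :
    (∀ f : ℝ≥0 → ℝ≥0, (∀ x y, f (x + y) ≤ f x + f y) →
      Tendsto (fun x => f x / x) atTop (𝓝 0) →
      ∃ (Δ : Type) (_ : Group Δ) (μ : PMF Δ),
        Group.FG Δ ∧ IsSymmFiniteGenerating μ ∧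
        (∀ S : Set Δ, IsFiniteGenerating S →
          ∃ c : ℝ, 0 < c ∧ ∀ n : ℕ, 1 ≤ n → c * (f (n : ℝ≥0) : ℝ) ≤ speed S μ n) ∧
        (∃ (F : Type) (_ : Group F) (_ : Finite F) (π : Δ →* lamplighter F),
          Function.Surjective π ∧
          ∀ S : Set Δ, IsFiniteGenerating S →
            ∀ h : Δ → ℝ, IsHarmonic μ h → HasSubexponentialGrowth S h →
              ∃ k : lamplighter F → ℝ, h = k ∘ π) ∧
        (∀ S : Set Δ, IsFiniteGenerating S → SublinearHarmonicConstant S μ)) ∧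
    (∃ (Δ : Type) (_ : Group Δ) (μ : PMF Δ),
      Group.FG Δ ∧ IsSymmFiniteGenerating μ ∧
      ∀ S : Set Δ, IsFiniteGenerating S →
        SublinearHarmonicConstant S μ ∧ ¬ HasDiffusiveSpeed S μ) := by
  refine (and_iff_left_of_imp fun h => ?_).2 fun f hf hlim => ?_
  · obtain ⟨Δ, hΔ, μ, hfg, hμ, hspeed, -, hconst⟩ := h (fun x => x ^ (3 / 4 : ℝ))
      (fun x y => NNReal.rpow_add_le_add_rpow x y (by norm_num) (by norm_num))
      tendsto_rpow_three_quarters_div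
    refine ⟨Δ, hΔ, μ, hfg, hμ, fun S hS => ⟨hconst S hS, ?_⟩⟩
    obtain ⟨c, hc, hcn⟩ := hspeed S hS
    exact not_hasDiffusiveSpeed_of_rpow_le hc hcn
  · obtain ⟨N, A, hA, hN⟩ := exists_depths hf hlim
    refine ⟨diagonalProduct N, inferInstance, diagMeasure N,
      Group.fg_iff.2 ⟨{diagSwitch N, diagShift N}, closure_diag_eq_top N, Set.toFinite _⟩,
      isSymmFiniteGenerating_lazyMeasure (diagSwitch_mul_self N) (closure_diag_eq_top N),
      fun S hS => ?_, ⟨ℤˣ, inferInstance, inferInstance, diagLamp N, diagLamp_surjective N,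
        fun S hS h hh hgrowth => exists_eq_comp_diagLamp N hS hh hgrowth⟩,
      fun S hS => sublinearHarmonicConstant_diag N hS⟩
    obtain ⟨C, hC⟩ := exists_le_mul_speed_diag N hS
    refine ⟨(A * C + 1)⁻¹, by positivity, fun n hn => ?_⟩
    obtain ⟨s, hs, hfs⟩ := hN n hn
    have hspeed : 0 ≤ speed S (diagMeasure N) n :=
      tsum_nonneg fun x => mul_nonneg ENNReal.toReal_nonneg (Nat.cast_nonneg _)
    have h1 := mul_le_mul_of_nonneg_left (hC s n hs) hA.le
    have h2 : (f n : ℝ) ≤ A * C * speed S (diagMeasure N) n := by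
      refine le_of_mul_le_mul_right ?_ (by positivity : (0 : ℝ) < 12 * (s + 2))
      linarith
    rw [inv_mul_le_iff₀ (by positivity)]
    linarith
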